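/- Let $W\colon\mathcal X\to\mathcal Y$ be a discrete memoryless channel with finite input and output alphabets and $|\mathcal X|=2^m$, let $P_X$ be any input distribution, and let $(X,Y)\sim P_{Y|X}P_X$. Fix a bijection $f\colon\{0,1\}^m\to\mathcal X$ and let $X^{\mathrm B,\ell}$, $1\le \ell\le m$, be the $\ell$-th bit of the label $f^{-1}(X)$. For $N=2^n$ let $(X_t,Y_t)_{1\le t\le N}$ be i.i.d. copies of $(X,Y)$, let $\mathbf X^{\mathrm B,\ell}\in\mathbb F_2^N$ be the vector of their $\ell$-th label bits, $\mathbf Y=(Y_1,\dots,Y_N)$, and let $\mathbf U^\ell=\mathbf X^{\mathrm B,\ell}G_N$, where $G_N=B_N\begin{pmatrix}1&0\\1&1\end{pmatrix}^{\otimes n}$ over $\mathbb F_2$ and $B_N$ is the bit-reversal permutation matrix. Put $\mathbf V^\ell_i=\big((U^\ell_j)_{j<i},(\mathbf X^{\mathrm B,k})_{k<\ell}\big)$. For a bit $A$ and a discrete random variable $B$ let $Z(A|B)=2\,\mathbb E\big[\sqrt{P_{A|B}(0|B)P_{A|B}(1|B)}\big]$. Let $\beta<\tfrac12$, $\delta_N=2^{-N^\beta}$,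 and define the following sets of pairs $(\ell,i)$ with $1\le\ell\le m$, $1\le i\le N$: $$\mathcal L'_U=\{Z(U^\ell_i|\mathbf V^\ell_i)<\delta_N\},\qquad \mathcal H'_U=\{Z(U^\ell_i|\mathbf V^\ell_i)>1-\delta_N\},$$ $$\mathcal L'_{U|Y}=\{Z(U^\ell_i|\mathbf V^\ell_i,\mathbf Y)<\delta_N\},\qquad \mathcal H'_{U|Y}=\{Z(U^\ell_i|\mathbf V^\ell_i,\mathbf Y)>1-\delta_N\}.$$ Then, as $N=2^n\to\infty$, $$\frac1N\big|\mathcal L'_U\cup\mathcal H'_{U|Y}\big|\to m-I(X;Y)\qquad\text{and}\qquad \frac1N\big|\mathcal I\big|\to I(X;Y),\quad\text{where }\mathcal I=\mathcal H'_U\cap\mathcal L'_{U|Y},$$ with the mutual information $I(X;Y)$ measured in bits. That is, the number of data positions per channel use attains the full mutual information for the given, possibly non-uniform, input distribution. -/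

import Mathlib

open Filter Topology
open scoped Kronecker Matrix

namespace MultilevelPolar

noncomputable section

/-! ### Finite probability -/

section Probability

variable {Ω α γ : Type*} [Fintype Ω]

open Classical in
/-- The law of the random variable `A : Ω → α` when `Ω` carries the probability mass
function `p`: `law p A a = Pr(A = a)`. -/
def law (p : Ω → ℝ) (A : Ω → α) (a : α) : ℝ :=
  ∑ ω with A ω = a, p ω

/-- The conditional probability `P_{A|B}(a|b) = Pr(A = a, B = b) / Pr(B = b)`
(it is only ever used with the weight `Pr(B = b)`). -/
def condProb (p : Ω → ℝ) (A : Ω → α) (B : Ω → γ) (a : α) (b : γ) : ℝ :=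
  law p (fun ω => (A ω, B ω)) (a, b) / law p B b

/-- The conditional Bhattacharyya parameter of a bit `A` given `B`,
`Z(A|B) = 2 E[√(P_{A|B}(0|B) P_{A|B}(1|B))]`. -/
def bhattacharyya [Fintype γ] (p : Ω → ℝ) (A : Ω → ZMod 2) (B : Ω → γ) : ℝ :=
  2 * ∑ b, law p B b * √(condProb p A B 0 b * condProb p A B 1 b)

/-- The mutual information `I(A;B)` in bits. Terms with `Pr(A = a, B = b) = 0` vanish. -/
def mutualInfo [Fintype α] [Fintype γ] (p : Ω → ℝ) (A : Ω → α) (B : Ω → γ) : ℝ :=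
  ∑ a, ∑ b, law p (fun ω => (A ω, B ω)) (a, b) *
    Real.logb 2 (law p (fun ω => (A ω, B ω)) (a, b) / (law p A a * law p B b))

end Probability

/-! ### The polar transform -/

/-- The kernel `F = [1 0; 1 1]` over `𝔽₂`. -/
def kernelF : Matrix (Fin 2) (Fin 2) (ZMod 2) := !![1, 0; 1, 1]

/-- The index `(b, r)` of a Kronecker product with a `2 × 2` matrix on the left corresponds to
`b * 2 ^ n + r`. -/
def kronIndex (n : ℕ) : Fin 2 × Fin (2 ^ n) ≃ Fin (2 ^ (n + 1)) :=
  finProdFinEquiv.trans (finCongr (pow_succ' 2 n).symm)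

/-- The `n`-fold Kronecker power of `F`. -/
def kronPow : (n : ℕ) → Matrix (Fin (2 ^ n)) (Fin (2 ^ n)) (ZMod 2)
  | 0 => 1
  | n + 1 => Matrix.reindex (kronIndex n) (kronIndex n) (kernelF ⊗ₖ kronPow n)

/-- The bit reversal of the `n`-digit binary expansion of an index. -/
def bitReversal (n : ℕ) : Equiv.Perm (Fin (2 ^ n)) :=
  finFunctionFinEquiv.symm.trans
    ((Equiv.arrowCongr Fin.revPerm (Equiv.refl (Fin 2))).trans finFunctionFinEquiv)

/-- The polar transform `G_N = B_N F^{⊗ n}`, `N = 2 ^ n`. -/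
def polarMatrix (n : ℕ) : Matrix (Fin (2 ^ n)) (Fin (2 ^ n)) (ZMod 2) :=
  (bitReversal n).permMatrix (ZMod 2) * kronPow n

/-! ### Multilevel polar coding over a discrete memoryless channel -/

section Multilevel

variable {𝒳 𝒴 : Type*} {m : ℕ}

/-- The joint probability mass function `P_X(x) P_{Y|X}(y|x)` of a channel input and output. -/
def jointLaw (P : PMF 𝒳) (W : 𝒳 → PMF 𝒴) (z : 𝒳 × 𝒴) : ℝ :=
  (P z.1).toReal * (W z.1 z.2).toReal

/-- The probability mass function of `N` i.i.d. draws from `q`. -/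
def iidLaw {α : Type*} (q : α → ℝ) (N : ℕ) (ω : Fin N → α) : ℝ :=
  ∏ t, q (ω t)

/-- The vector `X^{B,ℓ}` of the `ℓ`-th label bits of `N` channel inputs. -/
def bitLevel (f : (Fin m → ZMod 2) ≃ 𝒳) {N : ℕ} (ℓ : Fin m) (ω : Fin N → 𝒳 × 𝒴) :
    Fin N → ZMod 2 :=
  fun t => f.symm (ω t).1 ℓ

/-- The vector `Y` of the `N` channel outputs. -/
def outputs {N : ℕ} (ω : Fin N → 𝒳 × 𝒴) : Fin N → 𝒴 :=
  fun t => (ω t).2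

/-- The vector `U^ℓ = X^{B,ℓ} G_N`. -/
def polarBits (f : (Fin m → ZMod 2) ≃ 𝒳) (n : ℕ) (ℓ : Fin m) (ω : Fin (2 ^ n) → 𝒳 × 𝒴) :
    Fin (2 ^ n) → ZMod 2 :=
  bitLevel f ℓ ω ᵥ* polarMatrix n

/-- `V^ℓ_i`: the bits `U^ℓ_j`, `j < i`, of the same level together with the vectors `X^{B,k}`
of all lower levels `k < ℓ`. -/
def sideInfo (f : (Fin m → ZMod 2) ≃ 𝒳) (n : ℕ) (ℓ : Fin m) (i : Fin (2 ^ n))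
    (ω : Fin (2 ^ n) → 𝒳 × 𝒴) :
    ({j : Fin (2 ^ n) // j < i} → ZMod 2) × ({k : Fin m // k < ℓ} → Fin (2 ^ n) → ZMod 2) :=
  (fun j => polarBits f n ℓ ω j, fun k => bitLevel f k.1 ω)

variable [Fintype 𝒳] [Fintype 𝒴]

/-- `Z(U^ℓ_i | V^ℓ_i)`. -/
def zU (P : PMF 𝒳) (W : 𝒳 → PMF 𝒴) (f : (Fin m → ZMod 2) ≃ 𝒳) (n : ℕ)
    (ℓ : Fin m) (i : Fin (2 ^ n)) : ℝ :=
  bhattacharyya (iidLaw (jointLaw P W) (2 ^ n)) (fun ω => polarBits f n ℓ ω i)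
    (sideInfo f n ℓ i)

/-- `Z(U^ℓ_i | V^ℓ_i, Y)`. -/
def zUY (P : PMF 𝒳) (W : 𝒳 → PMF 𝒴) (f : (Fin m → ZMod 2) ≃ 𝒳) (n : ℕ)
    (ℓ : Fin m) (i : Fin (2 ^ n)) : ℝ :=
  bhattacharyya (iidLaw (jointLaw P W) (2 ^ n)) (fun ω => polarBits f n ℓ ω i)
    (fun ω => (sideInfo f n ℓ i ω, outputs ω))

/-- The threshold `δ_N = 2 ^ (-N ^ β)`, `N = 2 ^ n`. -/
def threshold (β : ℝ) (n : ℕ) : ℝ :=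
  (2 : ℝ) ^ (-(((2 ^ n : ℕ) : ℝ) ^ β))

open Classical in
/-- The set `L'_U`. -/
def lowU (P : PMF 𝒳) (W : 𝒳 → PMF 𝒴) (f : (Fin m → ZMod 2) ≃ 𝒳) (β : ℝ) (n : ℕ) :
    Finset (Fin m × Fin (2 ^ n)) :=
  {a | zU P W f n a.1 a.2 < threshold β n}

open Classical in
/-- The set `H'_U`. -/
def highU (P : PMF 𝒳) (W : 𝒳 → PMF 𝒴) (f : (Fin m → ZMod 2) ≃ 𝒳) (β : ℝ) (n : ℕ) :
    Finset (Fin m × Fin (2 ^ n)) :=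
  {a | zU P W f n a.1 a.2 > 1 - threshold β n}

open Classical in
/-- The set `L'_{U|Y}`. -/
def lowUY (P : PMF 𝒳) (W : 𝒳 → PMF 𝒴) (f : (Fin m → ZMod 2) ≃ 𝒳) (β : ℝ) (n : ℕ) :
    Finset (Fin m × Fin (2 ^ n)) :=
  {a | zUY P W f n a.1 a.2 < threshold β n}

open Classical in
/-- The set `H'_{U|Y}`. -/
def highUY (P : PMF 𝒳) (W : 𝒳 → PMF 𝒴) (f : (Fin m → ZMod 2) ≃ 𝒳) (β : ℝ) (n : ℕ) :
    Finset (Fin m × Fin (2 ^ n)) :=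
  {a | zUY P W f n a.1 a.2 > 1 - threshold β n}

/-- The data set `I = H'_U ∩ L'_{U|Y}`. -/
def dataSet (P : PMF 𝒳) (W : 𝒳 → PMF 𝒴) (f : (Fin m → ZMod 2) ≃ 𝒳) (β : ℝ) (n : ℕ) :
    Finset (Fin m × Fin (2 ^ n)) :=
  highU P W f β n ∩ lowUY P W f β n

/-- The mutual information `I(X;Y)` of the channel input and output, in bits. -/
def channelInfo (P : PMF 𝒳) (W : 𝒳 → PMF 𝒴) : ℝ :=
  mutualInfo (jointLaw P W) Prod.fst Prod.snd

end Multilevel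

end

end MultilevelPolar

/-!
A level of the label, with or without the channel output, is a bit `A` with side information `B`
(`BitSource`). The sums and the second bits of two independent copies give two new sources,
`minus` and `plus`; the `2 ^ n` transformed bits of a block, each given its past, are exactly the
sources at depth `n` of the resulting binary tree (`bhattacharyya_transform`). This holds because
the Bhattacharyya parameter depends on the conditioning only through the partition of the sample
space that it generates, and because the bit reversal merely permutes i.i.d. copies.

Polarization is controlled by two parameters with dual behaviour: the Bhattacharyya parameter `Z`,
which is squared by `plus` and at most doubled by `minus`, and the total variation parameter
`T = ∑ b, |Pr(A = 0, B = b) - Pr(A = 1, B = b)|`, which is squared by `minus` and at most doubled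
by `plus`. They satisfy `1 ≤ Z + T` and `Z² + T² ≤ 1`, so that `Z` is near `1` when `T` is small,
and `Z T` is small only if one of them is. The sharper bounds `2Z - Z²` and `2T - T²` make
`√(Z T)` contract on average by a constant factor. For small `Z T`, the function
`(-log₂ (Z T)) ^ (-θ)` contracts on average by a factor close to `(1 + 2 ^ (-θ)) / 2`, since one
branch essentially squares `Z T` and the other at most doubles it. Adding a large multiple of
`√(Z T)` gives one potential that contracts everywhere (`exists_potential`), and for small `θ` the
rate is better than `2 ^ (-θ β)` as long as `β < 1 / 2`. By Markov's inequality, the proportion of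
sources with both `Z` and `T` above `2 ^ (-N ^ β)` vanishes (`tendsto_frac_unpolarized`). This gives
the exponential rate at both extremes at once, without a separate martingale convergence argument.

The conditional entropy is conserved on average (`avg_H`), is at most `4 Z`, and differs from `1`
by at most `2 T`; hence the proportions of the sources with `Z` near `0` and near `1` tend to
`1 - H` and `H`. By the chain rule the entropies of the levels add up to the entropy of the channel
input, without or with the output (`sum_H_levelSource`). Conditioning on the output decreases `Z`,
so the two sets in the union are asymptotically disjoint, and up to a negligible set the data set is
the complement of their union.
-/

namespace MultilevelPolar

universe u v w

/-! ### Laws of finite random variables -/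

section Law

variable {Ω Ω' α α' γ γ' : Type*} [Fintype Ω] [Fintype Ω']

open Classical in
lemma law_eq_sum_ite (p : Ω → ℝ) (A : Ω → α) (a : α) :
    law p A a = ∑ ω, if A ω = a then p ω else 0 := by
  rw [law, Finset.sum_filter]

lemma law_nonneg {p : Ω → ℝ} (hp : ∀ ω, 0 ≤ p ω) (A : Ω → α) (a : α) : 0 ≤ law p A a :=
  Finset.sum_nonneg fun ω _ => hp ω

lemma law_congr {p : Ω → ℝ} {A : Ω → α} {A' : Ω → α'} {a : α} {a' : α'}
    (h : ∀ ω, A ω = a ↔ A' ω = a') : law p A a = law p A' a' := by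
  classical
  rw [law_eq_sum_ite, law_eq_sum_ite]
  exact Finset.sum_congr rfl fun ω _ => by simp only [h ω]

lemma sum_law_mul [Fintype α] (p : Ω → ℝ) (A : Ω → α) (g : α → ℝ) :
    ∑ a, law p A a * g a = ∑ ω, p ω * g (A ω) := by
  classical
  simp_rw [law_eq_sum_ite, Finset.sum_mul]
  rw [Finset.sum_comm]
  refine Finset.sum_congr rfl fun ω _ => ?_
  simp [ite_mul]

lemma sum_law [Fintype α] (p : Ω → ℝ) (A : Ω → α) : ∑ a, law p A a = ∑ ω, p ω := by
  simpa using sum_law_mul p A fun _ => 1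

lemma sum_law_pair [Fintype α] (p : Ω → ℝ) (A : Ω → α) (B : Ω → γ) (b : γ) :
    ∑ a, law p (fun ω => (A ω, B ω)) (a, b) = law p B b := by
  classical
  simp_rw [law_eq_sum_ite]
  rw [Finset.sum_comm]
  refine Finset.sum_congr rfl fun ω _ => ?_
  simp only [Prod.mk.injEq, ite_and]
  rw [Finset.sum_ite_eq]
  simp

lemma law_prod (p : Ω → ℝ) (q : Ω' → ℝ) (A : Ω → α) (B : Ω' → γ) (a : α) (b : γ) :
    law (fun z : Ω × Ω' => p z.1 * q z.2) (fun z => (A z.1, B z.2)) (a, b)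
      = law p A a * law q B b := by
  classical
  simp_rw [law_eq_sum_ite, Finset.sum_mul_sum, Fintype.sum_prod_type]
  refine Finset.sum_congr rfl fun ω _ => Finset.sum_congr rfl fun ω' _ => ?_
  by_cases h : A ω = a <;> by_cases h' : B ω' = b <;> simp [h, h']

lemma law_le_of_imp {p : Ω → ℝ} (hp : ∀ ω, 0 ≤ p ω) {A : Ω → α} {A' : Ω → α'} {a : α} {a' : α'}
    (h : ∀ ω, A ω = a → A' ω = a') : law p A a ≤ law p A' a' := by
  classical
  exact Finset.sum_le_sum_of_subset_of_nonneg
    (fun ω => by simpa using h ω) fun ω _ _ => hp ω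

lemma law_pos {p : Ω → ℝ} (hp : ∀ ω, 0 ≤ p ω) (A : Ω → α) {ω : Ω} (h : 0 < p ω) :
    0 < law p A (A ω) := by
  classical
  exact h.trans_le (Finset.single_le_sum (f := p) (fun ω _ => hp ω) (by simp))

lemma law_equiv (e : Ω ≃ Ω') {p : Ω → ℝ} {p' : Ω' → ℝ} (hp : ∀ ω, p' (e ω) = p ω)
    (A : Ω' → α) (a : α) : law p (fun ω => A (e ω)) a = law p' A a := by
  classical
  rw [law_eq_sum_ite, law_eq_sum_ite, ← e.sum_comp]
  simp only [hp]

/-- Two random variables that separate the same pairs of outcomes have the same law along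
corresponding values. -/
lemma law_eq_of_kernel_eq (e : Ω ≃ Ω') {p : Ω → ℝ} {p' : Ω' → ℝ} (hp : ∀ ω, p' (e ω) = p ω)
    {A : Ω → α} {A' : Ω' → α'} (h : ∀ ω ω', A' (e ω) = A' (e ω') ↔ A ω = A ω') (ω : Ω) :
    law p' A' (A' (e ω)) = law p A (A ω) := by
  rw [← law_equiv e hp]
  exact law_congr fun ω' => h ω' ω

/-- The Bhattacharyya parameter in terms of the joint law, without division: where `Pr(B = b)`
vanishes, so does the joint law. -/
lemma bhattacharyya_eq_sum_sqrt [Fintype γ] {p : Ω → ℝ} (hp : ∀ ω, 0 ≤ p ω) (A : Ω → ZMod 2)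
    (B : Ω → γ) :
    bhattacharyya p A B = 2 * ∑ b, √(law p (fun ω => (A ω, B ω)) (0, b) *
      law p (fun ω => (A ω, B ω)) (1, b)) := by
  rw [bhattacharyya]
  congr 1
  refine Finset.sum_congr rfl fun b _ => ?_
  have h0 := law_nonneg hp B b
  rw [condProb, condProb, div_mul_div_comm, ← sq, Real.sqrt_div' _ (sq_nonneg _),
    Real.sqrt_sq h0]
  rcases h0.eq_or_lt with h | h
  · have : law p (fun ω => (A ω, B ω)) (0, b) = 0 :=
      le_antisymm (h ▸ law_le_of_imp hp fun ω hω => (Prod.mk.inj hω).2) (law_nonneg hp _ _)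
    simp [this]
  · rw [mul_div_cancel₀ _ h.ne']

/-- The Bhattacharyya parameter depends on the conditioning variable only through the partition
of the sample space that it generates. -/
lemma bhattacharyya_congr [Fintype γ] [Fintype γ'] (e : Ω ≃ Ω') {p : Ω → ℝ} {p' : Ω' → ℝ}
    (hp : ∀ ω, p' (e ω) = p ω) {A : Ω → ZMod 2} {A' : Ω' → ZMod 2} (hA : ∀ ω, A' (e ω) = A ω)
    {B : Ω → γ} {B' : Ω' → γ'} (hB : ∀ ω ω', B' (e ω) = B' (e ω') ↔ B ω = B ω') :
    bhattacharyya p' A' B' = bhattacharyya p A B := by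
  rw [bhattacharyya, bhattacharyya, sum_law_mul, sum_law_mul, ← e.sum_comp]
  congr 1
  refine Finset.sum_congr rfl fun ω _ => ?_
  have key (a : ZMod 2) : condProb p' A' B' a (B' (e ω)) = condProb p A B a (B ω) := by
    rw [condProb, condProb, law_eq_of_kernel_eq e hp hB, ← law_equiv e hp]
    congr 1
    exact law_congr fun ω' => by simp [hA, hB]
  rw [hp, key, key]

/-- Conditioning reduces the Bhattacharyya parameter, by the Cauchy–Schwarz inequality. -/
lemma bhattacharyya_pair_le [Fintype γ] [Fintype γ'] {p : Ω → ℝ} (hp : ∀ ω, 0 ≤ p ω)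
    (A : Ω → ZMod 2) (B : Ω → γ) (C : Ω → γ') :
    bhattacharyya p A (fun ω => (B ω, C ω)) ≤ bhattacharyya p A B := by
  rw [bhattacharyya_eq_sum_sqrt hp, bhattacharyya_eq_sum_sqrt hp, Fintype.sum_prod_type]
  gcongr with b
  have hm (a : ZMod 2) : law p (fun ω => (A ω, B ω)) (a, b)
      = ∑ c, law p (fun ω => (A ω, (B ω, C ω))) (a, (b, c)) := by
    rw [← sum_law_pair p C]
    exact Finset.sum_congr rfl fun c _ => law_congr fun ω => by
      simp only [Prod.mk.injEq]; tauto
  rw [hm, hm, Real.sqrt_mul (Finset.sum_nonneg fun _ _ => law_nonneg hp _ _)]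
  simp_rw [Real.sqrt_mul (law_nonneg hp _ _)]
  exact Real.sum_sqrt_mul_sqrt_le _ (fun _ => law_nonneg hp _ _) (fun _ => law_nonneg hp _ _)

end Law

/-! ### Binary sources with side information -/

set_option linter.checkUnivs false in
/-- A bit `A` together with side information `B`, both functions on a finite probability space. -/
structure BitSource where
  /-- The sample space. -/
  Ω : Type u
  /-- The alphabet of the side information. -/
  γ : Type v
  [fintypeΩ : Fintype Ω]
  [fintypeγ : Fintype γ]
  /-- The probability mass function on the sample space. -/
  p : Ω → ℝ
  /-- The bit. -/
  A : Ω → ZMod 2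
  /-- The side information. -/
  B : Ω → γ
  nonneg : ∀ ω, 0 ≤ p ω
  total : ∑ ω, p ω = 1

attribute [instance] BitSource.fintypeΩ BitSource.fintypeγ

lemma sum_zmod_two {M : Type*} [AddCommMonoid M] (g : ZMod 2 → M) : ∑ x, g x = g 0 + g 1 :=
  Fin.sum_univ_two g

namespace BitSource

/-- The joint mass function of the bit and the side information. -/
noncomputable def joint (S : BitSource.{u, v}) (a : ZMod 2) (b : S.γ) : ℝ :=
  law S.p (fun ω => (S.A ω, S.B ω)) (a, b)

/-- The Bhattacharyya parameter of the bit given the side information. -/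
noncomputable def Z (S : BitSource.{u, v}) : ℝ := bhattacharyya S.p S.A S.B

/-- The total variation parameter `∑ b, |Pr(A = 0, B = b) - Pr(A = 1, B = b)|`. -/
noncomputable def T (S : BitSource.{u, v}) : ℝ := ∑ b, |S.joint 0 b - S.joint 1 b|

/-- The conditional entropy of the bit given the side information, in bits. -/
noncomputable def H (S : BitSource.{u, v}) : ℝ :=
  (∑ b, (Real.negMulLog (S.joint 0 b) + Real.negMulLog (S.joint 1 b)
    - Real.negMulLog (S.joint 0 b + S.joint 1 b))) / Real.log 2

/-- The sum of the bits of two independent copies, given both side informations. -/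
def minus (S : BitSource.{u, v}) : BitSource.{u, v} where
  Ω := S.Ω × S.Ω
  γ := S.γ × S.γ
  p z := S.p z.1 * S.p z.2
  A z := S.A z.1 + S.A z.2
  B z := (S.B z.1, S.B z.2)
  nonneg z := mul_nonneg (S.nonneg _) (S.nonneg _)
  total := by rw [Fintype.sum_prod_type, ← Finset.sum_mul_sum, S.total, one_mul]

/-- The second of the bits of two independent copies, given their sum and both side
informations. -/
def plus (S : BitSource.{u, v}) : BitSource.{u, v} where
  Ω := S.Ω × S.Ω
  γ := ZMod 2 × (S.γ × S.γ)
  p z := S.p z.1 * S.p z.2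
  A z := S.A z.2
  B z := (S.A z.1 + S.A z.2, (S.B z.1, S.B z.2))
  nonneg z := mul_nonneg (S.nonneg _) (S.nonneg _)
  total := by rw [Fintype.sum_prod_type, ← Finset.sum_mul_sum, S.total, one_mul]

variable (S : BitSource.{u, v})

lemma joint_nonneg (a : ZMod 2) (b : S.γ) : 0 ≤ S.joint a b := law_nonneg S.nonneg _ _

lemma joint_add_joint (b : S.γ) : S.joint 0 b + S.joint 1 b = law S.p S.B b := by
  rw [← sum_law_pair S.p S.A, sum_zmod_two]; rfl

lemma sum_joint : ∑ b, (S.joint 0 b + S.joint 1 b) = 1 := by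
  simp_rw [joint_add_joint, sum_law, S.total]

lemma Z_eq : S.Z = ∑ b, 2 * √(S.joint 0 b * S.joint 1 b) := by
  rw [Z, bhattacharyya_eq_sum_sqrt S.nonneg, Finset.mul_sum]; rfl

lemma joint_plus (r s : ZMod 2) (b c : S.γ) :
    S.plus.joint r (s, (b, c)) = S.joint (s + r) b * S.joint r c := by
  have := law_prod S.p S.p (fun ω => (S.A ω, S.B ω)) (fun ω => (S.A ω, S.B ω)) (s + r, b) (r, c)
  refine (law_congr fun z => ?_).trans this
  simp only [plus, Prod.mk.injEq]
  have h : ∀ r s x y : ZMod 2, (y = r ∧ x + y = s) ↔ (x = s + r ∧ y = r) := by decide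
  have := h r s (S.A z.1) (S.A z.2)
  tauto

lemma joint_minus (s : ZMod 2) (b c : S.γ) :
    S.minus.joint s (b, c) = S.joint s b * S.joint 0 c + S.joint (s + 1) b * S.joint 1 c := by
  have h : S.minus.joint s (b, c) = law S.plus.p S.plus.B (s, (b, c)) := rfl
  rw [h]
  refine (S.plus.joint_add_joint (s, (b, c))).symm.trans ?_
  rw [joint_plus, joint_plus, add_zero]

lemma sum_minus {M : Type*} [AddCommMonoid M] (g : S.minus.γ → M) :
    ∑ x, g x = ∑ b : S.γ, ∑ c : S.γ, g (b, c) :=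
  Fintype.sum_prod_type g

lemma sum_plus {M : Type*} [AddCommMonoid M] (g : S.plus.γ → M) :
    ∑ x, g x = ∑ b : S.γ, ∑ c : S.γ, (g (0, (b, c)) + g (1, (b, c))) := by
  have : ∑ x, g x = ∑ s : ZMod 2, ∑ y : S.γ × S.γ, g (s, y) := Fintype.sum_prod_type g
  rw [this, sum_zmod_two, ← Finset.sum_add_distrib, Fintype.sum_prod_type]

lemma one_add_one_zmod : (1 : ZMod 2) + 1 = 0 := by decide

/-! ### One step of the transform -/

lemma Z_nonneg : 0 ≤ S.Z := by
  rw [Z_eq]; positivity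

lemma T_nonneg : 0 ≤ S.T := by
  rw [T]; positivity

lemma Z_plus : S.plus.Z = S.Z ^ 2 := by
  rw [Z_eq, Z_eq, sum_plus, sq, Finset.sum_mul_sum]
  refine Finset.sum_congr rfl fun b _ => Finset.sum_congr rfl fun c _ => ?_
  simp only [joint_plus, one_add_one_zmod, zero_add, add_zero]
  have h0 := S.joint_nonneg 0 b
  have h1 := S.joint_nonneg 1 b
  rw [show S.joint 0 b * S.joint 0 c * (S.joint 1 b * S.joint 1 c)
      = (S.joint 0 b * S.joint 1 b) * (S.joint 0 c * S.joint 1 c) by ring,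
    show S.joint 1 b * S.joint 0 c * (S.joint 0 b * S.joint 1 c)
      = (S.joint 0 b * S.joint 1 b) * (S.joint 0 c * S.joint 1 c) by ring,
    Real.sqrt_mul (mul_nonneg h0 h1)]
  ring

lemma T_minus : S.minus.T = S.T ^ 2 := by
  rw [T, T, sum_minus, sq, Finset.sum_mul_sum]
  refine Finset.sum_congr rfl fun b _ => Finset.sum_congr rfl fun c _ => ?_
  simp only [joint_minus, one_add_one_zmod, zero_add]
  rw [← abs_mul]
  congr 1
  ring

/-- The pointwise inequality behind `Z_minus_le`. Its square, with `x = 2√(ab)` and `y = 2√(cd)`,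
leaves the gap `2xy (a + b - x) (c + d - y)`. -/
lemma two_mul_sqrt_minus_le {a b c d : ℝ} (ha : 0 ≤ a) (hb : 0 ≤ b) (hc : 0 ≤ c) (hd : 0 ≤ d) :
    2 * √((a * c + b * d) * (b * c + a * d)) ≤
      2 * √(a * b) * (c + d) + (a + b) * (2 * √(c * d)) - 2 * √(a * b) * (2 * √(c * d)) := by
  have hx2 : √(a * b) ^ 2 = a * b := Real.sq_sqrt (by positivity)
  have hy2 : √(c * d) ^ 2 = c * d := Real.sq_sqrt (by positivity)
  have hx0 := Real.sqrt_nonneg (a * b)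
  have hy0 := Real.sqrt_nonneg (c * d)
  set x := √(a * b)
  set y := √(c * d)
  have hx : 0 ≤ a + b - 2 * x := by nlinarith [sq_nonneg (a - b)]
  have hy : 0 ≤ c + d - 2 * y := by nlinarith [sq_nonneg (c - d)]
  have key : √((a * c + b * d) * (b * c + a * d)) ≤ x * (c + d) + (a + b) * y - 2 * x * y := by
    apply Real.sqrt_le_iff.2
    constructor
    · nlinarith [mul_nonneg hx0 (add_nonneg hc hd), mul_nonneg hx hy0]
    · have : 0 ≤ x * y * ((a + b - 2 * x) * (c + d - 2 * y)) := by positivity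
      have e : (a * c + b * d) * (b * c + a * d)
          = x ^ 2 * ((c + d) ^ 2 - 2 * y ^ 2) + y ^ 2 * ((a + b) ^ 2 - 2 * x ^ 2) := by
        rw [hx2, hy2]; ring
      rw [e]
      nlinarith [this]
  linarith

lemma sum_sum_expand (z : S.γ → ℝ) :
    ∑ b, ∑ c, (z b * (S.joint 0 c + S.joint 1 c) + (S.joint 0 b + S.joint 1 b) * z c - z b * z c)
      = 2 * ∑ b, z b - (∑ b, z b) ^ 2 := by
  simp only [Finset.sum_sub_distrib, Finset.sum_add_distrib, ← Finset.mul_sum, ← Finset.sum_mul]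
  have := S.sum_joint
  rw [Finset.sum_add_distrib] at this
  linear_combination (2 * ∑ b, z b) * this

lemma Z_minus_le : S.minus.Z ≤ 2 * S.Z - S.Z ^ 2 := by
  rw [Z_eq, Z_eq, sum_minus, ← sum_sum_expand]
  refine Finset.sum_le_sum fun b _ => Finset.sum_le_sum fun c _ => ?_
  simp only [joint_minus, one_add_one_zmod, zero_add]
  exact two_mul_sqrt_minus_le (S.joint_nonneg _ _) (S.joint_nonneg _ _) (S.joint_nonneg _ _)
    (S.joint_nonneg _ _)

/-- The pointwise inequality behind `T_plus_le`: the left-hand side is the larger of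
`(a + b) |c - d|` and `|a - b| (c + d)`. -/
lemma abs_add_abs_plus_le {a b c d : ℝ} (ha : 0 ≤ a) (hb : 0 ≤ b) (hc : 0 ≤ c) (hd : 0 ≤ d) :
    |a * c - b * d| + |b * c - a * d| ≤
      |a - b| * (c + d) + (a + b) * |c - d| - |a - b| * |c - d| := by
  have h1 : |a - b| ≤ a + b := abs_le.2 ⟨by linarith, by linarith⟩
  have h2 : |c - d| ≤ c + d := abs_le.2 ⟨by linarith, by linarith⟩
  have e1 : |a * c - b * d + (b * c - a * d)| = (a + b) * |c - d| := by
    rw [← abs_of_nonneg (add_nonneg ha hb), ← abs_mul]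
    congr 1
    ring
  have e2 : |a * c - b * d - (b * c - a * d)| = |a - b| * (c + d) := by
    rw [← abs_of_nonneg (add_nonneg hc hd), ← abs_mul]
    congr 1
    ring
  have b1 := mul_nonneg (abs_nonneg (a - b)) (sub_nonneg.2 h2)
  have b2 := mul_nonneg (sub_nonneg.2 h1) (abs_nonneg (c - d))
  have hmax : |a * c - b * d| + |b * c - a * d|
      ≤ max |a * c - b * d + (b * c - a * d)| |a * c - b * d - (b * c - a * d)| := by
    rw [le_max_iff]
    grind
  refine hmax.trans (max_le ?_ ?_)
  · rw [e1]; nlinarith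
  · rw [e2]; nlinarith

lemma T_plus_le : S.plus.T ≤ 2 * S.T - S.T ^ 2 := by
  rw [T, T, sum_plus, ← sum_sum_expand]
  refine Finset.sum_le_sum fun b _ => Finset.sum_le_sum fun c _ => ?_
  simp only [joint_plus, one_add_one_zmod, zero_add, add_zero]
  exact abs_add_abs_plus_le (S.joint_nonneg _ _) (S.joint_nonneg _ _) (S.joint_nonneg _ _)
    (S.joint_nonneg _ _)

lemma one_le_Z_add_T : 1 ≤ S.Z + S.T := by
  rw [Z_eq, T, ← Finset.sum_add_distrib, ← S.sum_joint]
  refine Finset.sum_le_sum fun b _ => ?_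
  have h0 := S.joint_nonneg 0 b
  have h1 := S.joint_nonneg 1 b
  set x := S.joint 0 b
  set y := S.joint 1 b
  rcases le_total x y with h | h
  · have : x ≤ √(x * y) := Real.le_sqrt_of_sq_le (by nlinarith)
    linarith [neg_le_abs (x - y)]
  · have : y ≤ √(x * y) := Real.le_sqrt_of_sq_le (by nlinarith)
    linarith [le_abs_self (x - y)]

lemma Z_sq_add_T_sq_le : S.Z ^ 2 + S.T ^ 2 ≤ 1 := by
  -- Each letter `b` contributes a vector `(2√(xy), |x - y|)` of Euclidean length `x + y`; pair
  -- these vectors with their sum `(Z, T)`.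
  set R := √(S.Z ^ 2 + S.T ^ 2)
  have hR : R ^ 2 = S.Z ^ 2 + S.T ^ 2 := Real.sq_sqrt (by positivity)
  have key : S.Z * S.Z + S.T * S.T ≤ R * 1 := by
    conv_lhs =>
      congr
      · rhs; rw [Z_eq]
      · rhs; rw [T]
    rw [← S.sum_joint, Finset.mul_sum, Finset.mul_sum, Finset.mul_sum, ← Finset.sum_add_distrib]
    refine Finset.sum_le_sum fun b _ => ?_
    have h0 := S.joint_nonneg 0 b
    have h1 := S.joint_nonneg 1 b
    set x := S.joint 0 b
    set y := S.joint 1 b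
    have hs : √(x * y) ^ 2 = x * y := Real.sq_sqrt (by positivity)
    have ht : |x - y| ^ 2 = (x - y) ^ 2 := sq_abs _
    refine abs_le_of_sq_le_sq' ?_ (by positivity) |>.2
    rw [mul_pow, hR]
    nlinarith [sq_nonneg (S.Z * |x - y| - S.T * (2 * √(x * y)))]
  have hR0 : 0 ≤ R := Real.sqrt_nonneg _
  nlinarith

lemma Z_le_one : S.Z ≤ 1 := by nlinarith [S.Z_sq_add_T_sq_le, sq_nonneg S.T]

lemma T_le_one : S.T ≤ 1 := by nlinarith [S.Z_sq_add_T_sq_le, sq_nonneg S.Z]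

/-! ### Conditional entropy -/

/-- The binary entropy in homogeneous form, split into the two logarithmic terms. -/
lemma negMulLog_add_sub {x y : ℝ} (hx : 0 ≤ x) (hy : 0 ≤ y) :
    Real.negMulLog x + Real.negMulLog y - Real.negMulLog (x + y)
      = x * Real.log ((x + y) / x) + y * Real.log ((x + y) / y) := by
  rcases hx.eq_or_lt with rfl | hx
  · rcases hy.eq_or_lt with rfl | hy
    · simp
    · simp [hy.ne']
  rcases hy.eq_or_lt with rfl | hy
  · simp [hx.ne']
  rw [Real.log_div (by positivity) hx.ne', Real.log_div (by positivity) hy.ne']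
  simp only [Real.negMulLog]
  ring

lemma mul_log_div_nonneg {x y : ℝ} (hx : 0 ≤ x) (hy : 0 ≤ y) : 0 ≤ x * Real.log ((x + y) / x) := by
  rcases hx.eq_or_lt with rfl | hx
  · simp
  · exact mul_nonneg hx.le (Real.log_nonneg ((one_le_div hx).2 (by linarith)))

lemma mul_log_div_le {x y : ℝ} (hx : 0 ≤ x) (hy : 0 ≤ y) :
    x * Real.log ((x + y) / x) ≤ 2 * √(x * y) := by
  rcases hx.eq_or_lt with rfl | hx
  · simp
  have h1 : (x + y) / x ≤ (1 + √(y / x)) ^ 2 := by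
    have := Real.sq_sqrt (show 0 ≤ y / x by positivity)
    have h0 := Real.sqrt_nonneg (y / x)
    rw [add_div, div_self hx.ne']
    nlinarith
  have h2 : Real.log ((x + y) / x) ≤ 2 * √(y / x) := by
    refine (Real.log_le_log (by positivity) h1).trans ?_
    rw [Real.log_pow]
    have := Real.log_le_sub_one_of_pos (show 0 < 1 + √(y / x) by positivity)
    push_cast
    linarith
  have h3 : x * √(y / x) = √(x * y) := by
    rw [show x * y = x ^ 2 * (y / x) by field_simp, Real.sqrt_mul (sq_nonneg x),
      Real.sqrt_sq hx.le]
  nlinarith [mul_le_mul_of_nonneg_left h2 hx.le]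

/-- The defect of the binary entropy from its maximum, bounded by the total variation. -/
lemma mul_log_div_ge {x y : ℝ} (hx : 0 ≤ x) (hy : 0 ≤ y) :
    (x + y) * Real.log 2 - |x - y| ≤
      x * Real.log ((x + y) / x) + y * Real.log ((x + y) / y) := by
  have aux {x y : ℝ} (hx : 0 ≤ x) (hy : 0 ≤ y) :
      x * Real.log 2 - x * (x - y) / (x + y) ≤ x * Real.log ((x + y) / x) := by
    rcases hx.eq_or_lt with rfl | hx
    · simp
    have h := Real.log_le_sub_one_of_pos (show 0 < 2 * x / (x + y) by positivity)
    have h' : Real.log ((x + y) / x) = Real.log 2 - Real.log (2 * x / (x + y)) := by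
      rw [← Real.log_div (by norm_num) (by positivity)]
      congr 1
      field_simp
    have e : x * (x - y) / (x + y) = x * (2 * x / (x + y) - 1) := by
      field_simp; ring
    rw [h', e]
    nlinarith
  have h1 := aux hx hy
  have h2 := aux hy hx
  rw [add_comm y x] at h2
  have h3 : x * (x - y) / (x + y) + y * (y - x) / (x + y) ≤ |x - y| := by
    rw [← add_div]
    refine div_le_of_le_mul₀ (by positivity) (abs_nonneg _) ?_
    have : |x - y| ≤ x + y := abs_le.2 ⟨by linarith, by linarith⟩
    nlinarith [sq_abs (x - y), abs_nonneg (x - y)]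
  linarith

lemma mul_log_div_le_log_two {x y : ℝ} (hx : 0 ≤ x) (hy : 0 ≤ y) :
    x * Real.log ((x + y) / x) + y * Real.log ((x + y) / y) ≤ (x + y) * Real.log 2 := by
  have aux {x y : ℝ} (hx : 0 ≤ x) (hy : 0 ≤ y) :
      x * Real.log ((x + y) / x) ≤ x * Real.log 2 + (y - x) / 2 := by
    rcases hx.eq_or_lt with rfl | hx
    · simpa using by linarith
    have h := Real.log_le_sub_one_of_pos (show 0 < (x + y) / (2 * x) by positivity)
    have h' : Real.log ((x + y) / x) = Real.log 2 + Real.log ((x + y) / (2 * x)) := by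
      rw [← Real.log_mul (by norm_num) (by positivity)]
      congr 1
      field_simp
    have e : x * ((x + y) / (2 * x) - 1) = (y - x) / 2 := by
      field_simp; ring
    rw [h', ← e]
    nlinarith
  have h1 := aux hx hy
  have h2 := aux hy hx
  rw [add_comm y x] at h2
  linarith

lemma H_eq : S.H = (∑ b, (S.joint 0 b * Real.log ((S.joint 0 b + S.joint 1 b) / S.joint 0 b)
    + S.joint 1 b * Real.log ((S.joint 0 b + S.joint 1 b) / S.joint 1 b))) / Real.log 2 := by
  rw [H]
  congr 1
  exact Finset.sum_congr rfl fun b _ => negMulLog_add_sub (S.joint_nonneg _ _) (S.joint_nonneg _ _)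

lemma H_nonneg : 0 ≤ S.H := by
  rw [H_eq]
  refine div_nonneg (Finset.sum_nonneg fun b _ => ?_) (Real.log_nonneg (by norm_num))
  have h0 := S.joint_nonneg 0 b
  have h1 := S.joint_nonneg 1 b
  have := mul_log_div_nonneg h1 h0
  rw [add_comm] at this
  exact add_nonneg (mul_log_div_nonneg h0 h1) this

lemma H_le_one : S.H ≤ 1 := by
  rw [H_eq, div_le_one (Real.log_pos (by norm_num)), ← one_mul (Real.log 2), ← S.sum_joint,
    Finset.sum_mul]
  exact Finset.sum_le_sum fun b _ => mul_log_div_le_log_two (S.joint_nonneg _ _)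
    (S.joint_nonneg _ _)

lemma H_le_mul_Z : S.H ≤ 4 * S.Z := by
  have hl : 1 / 2 ≤ Real.log 2 := by linarith [Real.log_two_gt_d9]
  have : S.H * Real.log 2 ≤ 2 * S.Z := by
    rw [H_eq, div_mul_cancel₀ _ (by linarith), Z_eq, Finset.mul_sum]
    refine Finset.sum_le_sum fun b _ => ?_
    have h0 := S.joint_nonneg 0 b
    have h1 := S.joint_nonneg 1 b
    have := mul_log_div_le h1 h0
    rw [add_comm (S.joint 1 b), mul_comm (S.joint 1 b) (S.joint 0 b)] at this
    linarith [mul_log_div_le h0 h1]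
  nlinarith [S.H_nonneg]

lemma one_sub_H_le_mul_T : 1 - S.H ≤ 2 * S.T := by
  have hl : 1 / 2 ≤ Real.log 2 := by linarith [Real.log_two_gt_d9]
  have : 1 * Real.log 2 - S.T ≤ S.H * Real.log 2 := by
    rw [H_eq, div_mul_cancel₀ _ (by linarith), T, ← S.sum_joint, Finset.sum_mul,
      ← Finset.sum_sub_distrib]
    exact Finset.sum_le_sum fun b _ => mul_log_div_ge (S.joint_nonneg _ _) (S.joint_nonneg _ _)
  nlinarith [S.H_le_one]

lemma sum_sum_negMulLog_mul {α β : Type*} [Fintype α] [Fintype β] (g : α → ℝ) (h : β → ℝ) :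
    ∑ a, ∑ b, Real.negMulLog (g a * h b)
      = (∑ b, h b) * ∑ a, Real.negMulLog (g a) + (∑ a, g a) * ∑ b, Real.negMulLog (h b) := by
  simp_rw [Real.negMulLog_mul, Finset.sum_add_distrib, ← Finset.sum_mul, ← Finset.mul_sum,
    ← Finset.sum_mul]

/-- The chain rule: the two synthesized bits carry together the entropy of two copies. -/
lemma H_minus_add_H_plus : S.minus.H + S.plus.H = 2 * S.H := by
  rw [H, H, H, ← add_div, ← mul_div_assoc]
  congr 1
  have hs : ∑ b, S.joint 0 b + ∑ b, S.joint 1 b = 1 := by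
    rw [← Finset.sum_add_distrib, S.sum_joint]
  have e1 := sum_sum_negMulLog_mul (fun b => S.joint 0 b + S.joint 1 b)
    (fun b => S.joint 0 b + S.joint 1 b)
  have e00 := sum_sum_negMulLog_mul (S.joint 0) (S.joint 0)
  have e01 := sum_sum_negMulLog_mul (S.joint 0) (S.joint 1)
  have e10 := sum_sum_negMulLog_mul (S.joint 1) (S.joint 0)
  have e11 := sum_sum_negMulLog_mul (S.joint 1) (S.joint 1)
  rw [S.sum_joint] at e1
  rw [sum_minus, sum_plus, ← Finset.sum_add_distrib]
  have : ∀ b c : S.γ,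
      Real.negMulLog (S.minus.joint 0 (b, c)) + Real.negMulLog (S.minus.joint 1 (b, c))
        - Real.negMulLog (S.minus.joint 0 (b, c) + S.minus.joint 1 (b, c))
      + ((Real.negMulLog (S.plus.joint 0 (0, (b, c))) + Real.negMulLog (S.plus.joint 1 (0, (b, c)))
        - Real.negMulLog (S.plus.joint 0 (0, (b, c)) + S.plus.joint 1 (0, (b, c))))
      + (Real.negMulLog (S.plus.joint 0 (1, (b, c))) + Real.negMulLog (S.plus.joint 1 (1, (b, c)))
        - Real.negMulLog (S.plus.joint 0 (1, (b, c)) + S.plus.joint 1 (1, (b, c)))))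
      = Real.negMulLog (S.joint 0 b * S.joint 0 c) + Real.negMulLog (S.joint 0 b * S.joint 1 c)
        + Real.negMulLog (S.joint 1 b * S.joint 0 c) + Real.negMulLog (S.joint 1 b * S.joint 1 c)
        - Real.negMulLog ((S.joint 0 b + S.joint 1 b) * (S.joint 0 c + S.joint 1 c)) := by
    intro b c
    simp only [joint_minus, joint_plus, one_add_one_zmod, zero_add, add_zero]
    rw [show S.joint 0 b * S.joint 0 c + S.joint 1 b * S.joint 1 c
      + (S.joint 1 b * S.joint 0 c + S.joint 0 b * S.joint 1 c)
      = (S.joint 0 b + S.joint 1 b) * (S.joint 0 c + S.joint 1 c) by ring]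
    ring
  simp_rw [← Finset.sum_add_distrib, this]
  simp only [Finset.sum_add_distrib, Finset.sum_sub_distrib] at e1 ⊢
  rw [e00, e01, e10, e11, e1]
  linear_combination
    2 * (∑ b, Real.negMulLog (S.joint 0 b) + ∑ b, Real.negMulLog (S.joint 1 b)) * hs

end BitSource

/-! ### The polarization tree -/

/-- The source obtained from `S` by the `n` single steps encoded in the binary digits of `i`,
the most significant digit first; the digit `0` stands for `minus` and `1` for `plus`. -/
noncomputable def node : (n : ℕ) → BitSource.{u, v} → Fin (2 ^ n) → BitSource.{u, v}
  | 0, S, _ => S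
  | n + 1, S, i => node n (if ((kronIndex n).symm i).1 = 0 then S.minus else S.plus)
      ((kronIndex n).symm i).2

lemma node_zero (n : ℕ) (S : BitSource.{u, v}) (j : Fin (2 ^ n)) :
    node (n + 1) S (kronIndex n (0, j)) = node n S.minus j := by
  simp [node]

lemma node_one (n : ℕ) (S : BitSource.{u, v}) (j : Fin (2 ^ n)) :
    node (n + 1) S (kronIndex n (1, j)) = node n S.plus j := by
  simp [node]

/-- The average of `φ` over the `2 ^ n` sources at depth `n` of the tree. -/
noncomputable def avg (n : ℕ) (φ : BitSource.{u, v} → ℝ) (S : BitSource.{u, v}) : ℝ :=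
  (∑ i, φ (node n S i)) / 2 ^ n

lemma avg_zero (φ : BitSource.{u, v} → ℝ) (S : BitSource.{u, v}) : avg 0 φ S = φ S := by
  simp [avg, node]

lemma avg_succ (n : ℕ) (φ : BitSource.{u, v} → ℝ) (S : BitSource.{u, v}) :
    avg (n + 1) φ S = (avg n φ S.minus + avg n φ S.plus) / 2 := by
  rw [avg, avg, avg, ← (kronIndex n).sum_comp, Fintype.sum_prod_type, Fin.sum_univ_two]
  simp only [node_zero, node_one]
  rw [pow_succ]
  ring

lemma avg_mono (n : ℕ) {φ ψ : BitSource.{u, v} → ℝ} (h : ∀ S, φ S ≤ ψ S) (S : BitSource.{u, v}) :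
    avg n φ S ≤ avg n ψ S := by
  unfold avg
  gcongr
  exact h _

lemma avg_const_mul (n : ℕ) (c : ℝ) (φ : BitSource.{u, v} → ℝ) (S : BitSource.{u, v}) :
    avg n (fun S => c * φ S) S = c * avg n φ S := by
  rw [avg, avg, ← Finset.mul_sum, mul_div_assoc]

lemma avg_add (n : ℕ) (φ ψ : BitSource.{u, v} → ℝ) (S : BitSource.{u, v}) :
    avg n (fun S => φ S + ψ S) S = avg n φ S + avg n ψ S := by
  rw [avg, avg, avg, Finset.sum_add_distrib, add_div]

lemma avg_const (n : ℕ) (c : ℝ) (S : BitSource.{u, v}) : avg n (fun _ => c) S = c := by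
  simp [avg]

lemma avg_le_pow_mul {ρ : ℝ} (hρ : 0 ≤ ρ) {φ : BitSource.{u, v} → ℝ}
    (h : ∀ S, φ S.minus + φ S.plus ≤ 2 * ρ * φ S) (n : ℕ) (S : BitSource.{u, v}) :
    avg n φ S ≤ ρ ^ n * φ S := by
  induction n generalizing S with
  | zero => simp [avg_zero]
  | succ n ih =>
    rw [avg_succ]
    have h1 := ih S.minus
    have h2 := ih S.plus
    have h3 := mul_le_mul_of_nonneg_left (h S) (pow_nonneg hρ n)
    rw [pow_succ]
    linarith

/-- The average conditional entropy is conserved along the tree. -/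
lemma avg_H (n : ℕ) (S : BitSource.{u, v}) : avg n BitSource.H S = S.H := by
  induction n generalizing S with
  | zero => rw [avg_zero]
  | succ n ih => rw [avg_succ, ih, ih, S.H_minus_add_H_plus]; ring

/-! ### A contracting potential -/

lemma sqrt_le_half_add {x : ℝ} (c : ℝ) (hc : 0 < c) (hx : 0 ≤ x) : √x ≤ (x / c + c) / 2 := by
  have h : x / c * c = x := div_mul_cancel₀ x hc.ne'
  apply Real.sqrt_le_iff.2
  constructor
  · positivity
  · nlinarith [sq_nonneg (x / c - c)]

lemma sqrt_add_sqrt_le_of_large {z t : ℝ} (hz : 0 ≤ z) (ht1 : t ≤ 1)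
    (h : z ^ 2 + t ^ 2 ≤ 1) (ht : 9 / 10 < t) :
    √((2 - z) * t) + √(z * (2 - t)) ≤ 199 / 100 := by
  have hz' : z ≤ 44 / 100 := by nlinarith
  have h1 := sqrt_le_half_add (x := (2 - z) * t) (5 / 4) (by norm_num) (by nlinarith)
  have h2 := sqrt_le_half_add (x := z * (2 - t)) (7 / 10) (by norm_num) (by nlinarith)
  have h3 : (2 - z) * t ≤ 2 - z := by nlinarith
  have h4 : z * (2 - t) ≤ z * (11 / 10) := by nlinarith
  linarith

lemma sqrt_add_sqrt_le {z t : ℝ} (hz : 0 ≤ z) (ht : 0 ≤ t) (h : z ^ 2 + t ^ 2 ≤ 1) :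
    √((2 - z) * t) + √(z * (2 - t)) ≤ 199 / 100 := by
  have hz1 : z ≤ 1 := by nlinarith
  have ht1 : t ≤ 1 := by nlinarith
  rcases lt_or_ge (9 / 10) t with h1 | h1
  · exact sqrt_add_sqrt_le_of_large hz ht1 h h1
  rcases lt_or_ge (9 / 10) z with h2 | h2
  · have := sqrt_add_sqrt_le_of_large ht hz1 (by linarith) h2
    rw [add_comm, mul_comm (2 - z), mul_comm z]
    exact this
  have h1 := sqrt_le_half_add (x := (2 - z) * t) 1 (by norm_num) (by nlinarith)
  have h2 := sqrt_le_half_add (x := z * (2 - t)) 1 (by norm_num) (by nlinarith)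
  nlinarith

namespace BitSource

variable (S : BitSource.{u, v})

lemma Z_mul_T_nonneg : 0 ≤ S.Z * S.T := mul_nonneg S.Z_nonneg S.T_nonneg

lemma Z_mul_T_le : S.Z * S.T ≤ 1 / 2 := by
  nlinarith [S.Z_sq_add_T_sq_le, sq_nonneg (S.Z - S.T)]

/-- The quantity `√(Z T)` contracts on average by a constant factor. This is the basic
polarization statement: it forces `Z T → 0`, hence `Z → 0` or `T → 0`, along almost all paths. -/
lemma sqrt_Z_mul_T_contract :
    √(S.minus.Z * S.minus.T) + √(S.plus.Z * S.plus.T) ≤ 2 * (199 / 200) * √(S.Z * S.T) := by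
  have hz := S.Z_nonneg
  have ht := S.T_nonneg
  have h1 : √(S.minus.Z * S.minus.T) ≤ √(S.Z * S.T) * √((2 - S.Z) * S.T) := by
    rw [← Real.sqrt_mul S.Z_mul_T_nonneg, T_minus]
    refine Real.sqrt_le_sqrt ?_
    nlinarith [mul_le_mul_of_nonneg_right S.Z_minus_le (sq_nonneg S.T)]
  have h2 : √(S.plus.Z * S.plus.T) ≤ √(S.Z * S.T) * √(S.Z * (2 - S.T)) := by
    rw [← Real.sqrt_mul S.Z_mul_T_nonneg, Z_plus]
    refine Real.sqrt_le_sqrt ?_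
    nlinarith [mul_le_mul_of_nonneg_left S.T_plus_le (sq_nonneg S.Z)]
  have h3 := mul_le_mul_of_nonneg_left (sqrt_add_sqrt_le hz ht S.Z_sq_add_T_sq_le)
    (Real.sqrt_nonneg (S.Z * S.T))
  linarith

end BitSource

/-- The potential `(-log₂ x) ^ (-θ)`. Squaring `x` multiplies it by `2 ^ (-θ)`, and doubling a small
`x` hardly changes it. Its value at `x = 0` is `0`, because `Real.log 0 = 0` and `0 ^ (-θ) = 0`;
this is the correct limit. -/
noncomputable def logPot (θ x : ℝ) : ℝ := (-Real.logb 2 x) ^ (-θ)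

lemma logPot_zero {θ : ℝ} (hθ : 0 < θ) : logPot θ 0 = 0 := by
  simp [logPot, Real.zero_rpow (neg_ne_zero.2 hθ.ne')]

lemma neg_logb_pos {x : ℝ} (h0 : 0 < x) (h1 : x < 1) : 0 < -Real.logb 2 x :=
  neg_pos.2 (Real.logb_neg (by norm_num) h0 h1)

lemma logPot_nonneg (θ : ℝ) {x : ℝ} (h0 : 0 ≤ x) (h1 : x ≤ 1) : 0 ≤ logPot θ x :=
  Real.rpow_nonneg (neg_nonneg.2 (Real.logb_nonpos (by norm_num) h0 h1)) _

lemma logPot_mono {θ x y : ℝ} (hθ : 0 < θ) (hx : 0 ≤ x) (hxy : x ≤ y) (hy : y < 1) :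
    logPot θ x ≤ logPot θ y := by
  rcases hx.eq_or_lt with rfl | hx
  · rw [logPot_zero hθ]
    exact logPot_nonneg θ hxy hy.le
  · refine Real.rpow_le_rpow_of_nonpos (neg_logb_pos (hx.trans_le hxy) hy) ?_ (by linarith)
    exact neg_le_neg (Real.logb_le_logb_of_le (by norm_num) hx hxy)

lemma logPot_half (θ : ℝ) : logPot θ (1 / 2) = 1 := by
  have : Real.logb 2 (1 / 2) = -1 := by
    rw [one_div, Real.logb_inv, Real.logb_self_eq_one (by norm_num)]
  rw [logPot, this, neg_neg, Real.one_rpow]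

lemma logPot_sq (θ : ℝ) {x : ℝ} (h0 : 0 ≤ x) (h1 : x ≤ 1) :
    logPot θ (x ^ 2) = 2 ^ (-θ) * logPot θ x := by
  rw [logPot, logPot, Real.logb_pow, ← Real.mul_rpow (by norm_num)
    (neg_nonneg.2 (Real.logb_nonpos (by norm_num) h0 h1))]
  congr 1
  push_cast
  ring

/-- One step from a state `(z, t)` with `z ≤ t`: the product `z t` is essentially squared on the
branch that squares `z`, and at most doubled on the other one. -/
lemma logPot_step {θ z t p q : ℝ} (hθ : 0 < θ) (hz : 0 ≤ z) (hzt : z ≤ t) (h1 : 1 ≤ z + t)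
    (hx : 2 * (z * t) < 1) (hp : 0 ≤ p) (hp' : p ≤ z ^ 2) (hq : 0 ≤ q) (hq' : q ≤ 2 * (z * t)) :
    logPot θ p + logPot θ q ≤ (1 + 2 ^ (-θ)) * logPot θ (2 * (z * t)) := by
  have ht : 1 / 2 ≤ t := by linarith
  have hx0 : 0 ≤ z * t := by positivity
  have e1 : logPot θ p ≤ logPot θ ((2 * (z * t)) ^ 2) := by
    refine logPot_mono hθ hp (hp'.trans ?_) (by nlinarith)
    exact pow_le_pow_left₀ hz (by nlinarith) 2
  have e2 : logPot θ q ≤ logPot θ (2 * (z * t)) := logPot_mono hθ hq hq' hx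
  rw [logPot_sq θ (by positivity) hx.le] at e1
  linarith

namespace BitSource

lemma logPot_le_one {θ : ℝ} (hθ : 0 < θ) (S : BitSource.{u, v}) : logPot θ (S.Z * S.T) ≤ 1 := by
  rw [← logPot_half θ]
  exact logPot_mono hθ S.Z_mul_T_nonneg S.Z_mul_T_le (by norm_num)

lemma logPot_minus_add_plus {θ : ℝ} (hθ : 0 < θ) (S : BitSource.{u, v})
    (hx : 2 * (S.Z * S.T) < 1) :
    logPot θ (S.minus.Z * S.minus.T) + logPot θ (S.plus.Z * S.plus.T)
      ≤ (1 + 2 ^ (-θ)) * logPot θ (2 * (S.Z * S.T)) := by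
  have hz := S.Z_nonneg
  have ht := S.T_nonneg
  have hz1 := S.Z_le_one
  have ht1 := S.T_le_one
  have hzm : S.minus.Z ≤ 2 * S.Z := by nlinarith [S.Z_minus_le]
  have htp : S.plus.T ≤ 2 * S.T := by nlinarith [S.T_plus_le]
  have m0 := S.minus.Z_mul_T_nonneg
  have p0 := S.plus.Z_mul_T_nonneg
  have m1 : S.minus.Z * S.minus.T ≤ S.T ^ 2 := by
    rw [T_minus]; nlinarith [S.minus.Z_le_one, sq_nonneg S.T]
  have p1 : S.plus.Z * S.plus.T ≤ S.Z ^ 2 := by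
    rw [Z_plus]; nlinarith [S.plus.T_le_one, sq_nonneg S.Z]
  have m2 : S.minus.Z * S.minus.T ≤ 2 * (S.Z * S.T) := by
    rw [T_minus]
    nlinarith [mul_le_mul_of_nonneg_right hzm (sq_nonneg S.T), mul_nonneg hz ht,
      mul_nonneg (mul_nonneg hz ht) (sub_nonneg.2 ht1)]
  have p2 : S.plus.Z * S.plus.T ≤ 2 * (S.Z * S.T) := by
    rw [Z_plus]
    nlinarith [mul_le_mul_of_nonneg_left htp (sq_nonneg S.Z), mul_nonneg hz ht,
      mul_nonneg (mul_nonneg hz ht) (sub_nonneg.2 hz1)]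
  rcases le_total S.Z S.T with h | h
  · rw [add_comm]
    exact logPot_step hθ hz h S.one_le_Z_add_T hx p0 p1 m0 m2
  · rw [mul_comm S.Z] at hx m2 p2 ⊢
    exact logPot_step hθ ht h (by linarith [S.one_le_Z_add_T]) hx m0 m1 p0 p2

end BitSource

/-- Doubling a sufficiently small `x` costs an arbitrarily small factor. -/
lemma exists_logPot_two_mul_le {θ c ρ : ℝ} (hθ : 0 < θ) (hcρ : c < ρ) :
    ∃ x₀ : ℝ, 0 < x₀ ∧ x₀ < 1 / 2 ∧
      ∀ x, 0 ≤ x → x ≤ x₀ → c * logPot θ (2 * x) ≤ ρ * logPot θ x := by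
  have hlim : Tendsto (fun L : ℝ => c * (L / (L - 1)) ^ θ) atTop (𝓝 c) := by
    have h1 : Tendsto (fun L : ℝ => L / (L - 1)) atTop (𝓝 1) := by
      have : Tendsto (fun L : ℝ => 1 + (L - 1)⁻¹) atTop (𝓝 (1 + 0)) :=
        tendsto_const_nhds.add (tendsto_inv_atTop_zero.comp (tendsto_atTop_add_const_right _ _
          tendsto_id))
      rw [add_zero] at this
      refine this.congr' ?_
      filter_upwards [eventually_gt_atTop 1] with L hL
      have : L - 1 ≠ 0 := by linarith
      field_simp
      ring
    have h2 := (h1.rpow_const (p := θ) (Or.inl one_ne_zero)).const_mul c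
    simpa using h2
  obtain ⟨L₀, hL₀⟩ := eventually_atTop.1 ((hlim.eventually_lt_const hcρ).and
    (eventually_gt_atTop 1))
  have hL1 : 1 < L₀ := (hL₀ L₀ le_rfl).2
  refine ⟨2 ^ (-L₀), by positivity, ?_, fun x hx hxx => ?_⟩
  · have : (2 : ℝ) ^ (-L₀) < 2 ^ (-1 : ℝ) :=
      Real.rpow_lt_rpow_of_exponent_lt (by norm_num) (by linarith)
    rw [Real.rpow_neg_one] at this
    linarith
  rcases hx.eq_or_lt with rfl | hx
  · simp [logPot_zero hθ]
  set L := -Real.logb 2 x with hL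
  have hLL : L₀ ≤ L := by
    have := Real.logb_le_logb_of_le (b := 2) (by norm_num) hx hxx
    rw [Real.logb_rpow (by norm_num) (by norm_num)] at this
    linarith
  have hd : -Real.logb 2 (2 * x) = L - 1 := by
    rw [Real.logb_mul (by norm_num) hx.ne', Real.logb_self_eq_one (by norm_num), hL]
    ring
  rw [logPot, logPot, hd, ← hL]
  have h := (hL₀ L hLL).1
  have hLpos : 0 < L := by linarith
  have hL1pos : 0 < L - 1 := by linarith
  rw [Real.div_rpow hLpos.le hL1pos.le, ← mul_div_assoc, div_lt_iff₀ (by positivity)] at h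
  rw [Real.rpow_neg hLpos.le, Real.rpow_neg hL1pos.le, ← div_eq_mul_inv, ← div_eq_mul_inv,
    div_le_div_iff₀ (by positivity) (by positivity)]
  exact h.le

/-- For `β < 1 / 2` the function `2 ^ (θ β) (1 + 2 ^ (-θ)) / 2` has value `1` and negative
derivative at `θ = 0`, so it is below `1` for small positive `θ`. -/
lemma exists_exponent {β : ℝ} (hβ : β < 1 / 2) :
    ∃ θ : ℝ, 0 < θ ∧ 2 ^ (θ * β) * ((1 + 2 ^ (-θ)) / 2) < (1 : ℝ) ∧
      2 ^ (θ * β) * (199 / 200) < (1 : ℝ) := by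
  have hd1 : HasDerivAt (fun θ : ℝ => (2 : ℝ) ^ (θ * β)) (Real.log 2 * β) 0 := by
    have := ((hasDerivAt_id (0 : ℝ)).mul_const β).const_rpow (a := 2) (by norm_num)
    simpa using this
  have hd2 : HasDerivAt (fun θ : ℝ => (1 + (2 : ℝ) ^ (-θ)) / 2) (-Real.log 2 / 2) 0 := by
    have := (((hasDerivAt_id (0 : ℝ)).neg.const_rpow (a := 2) (by norm_num)).const_add
      1).div_const 2
    simpa using this
  have hd := hd1.mul hd2
  have hneg : Real.log 2 * β * ((1 + (2 : ℝ) ^ (-(0 : ℝ))) / 2)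
      + 2 ^ ((0 : ℝ) * β) * (-Real.log 2 / 2) < 0 := by
    have := Real.log_pos (show (1 : ℝ) < 2 by norm_num)
    norm_num
    nlinarith
  have hs := (hasDerivAt_iff_tendsto_slope.1 hd).mono_left
    (nhdsWithin_mono 0 (fun x (hx : x ∈ Set.Ioi (0 : ℝ)) => ne_of_gt hx))
  have h1 := hs.eventually_lt_const hneg
  have h2 : ∀ᶠ θ : ℝ in 𝓝[>] 0, (2 : ℝ) ^ (θ * β) * (199 / 200) < 1 := by
    have hc : Tendsto (fun θ : ℝ => (2 : ℝ) ^ (θ * β) * (199 / 200)) (𝓝 0)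
        (𝓝 (2 ^ ((0 : ℝ) * β) * (199 / 200))) := (hd1.continuousAt.tendsto).mul_const _
    exact (hc.eventually_lt_const (by norm_num)).filter_mono nhdsWithin_le_nhds
  obtain ⟨θ, ⟨h1, h2⟩, hθ⟩ := ((h1.and h2).and self_mem_nhdsWithin).exists
  refine ⟨θ, hθ, ?_, h2⟩
  have hθ' : 0 < θ := hθ
  rw [slope_def_field, div_lt_iff₀ (by simpa using hθ')] at h1
  simp only [Pi.mul_apply] at h1
  norm_num at h1
  linarith

/-- A potential that contracts on average by a factor `ρ < 2 ^ (-θ β)`: where `Z T` is small,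
`logPot` contracts by itself; elsewhere it is dominated by a large multiple of `√(Z T)`. -/
lemma exists_potential {β : ℝ} (hβ : β < 1 / 2) :
    ∃ θ ρ C : ℝ, 0 < θ ∧ 0 < ρ ∧ 0 ≤ C ∧ 2 ^ (θ * β) * ρ < 1 ∧ ∀ S : BitSource.{u, v},
      (logPot θ (S.minus.Z * S.minus.T) + C * √(S.minus.Z * S.minus.T))
        + (logPot θ (S.plus.Z * S.plus.T) + C * √(S.plus.Z * S.plus.T))
        ≤ 2 * ρ * (logPot θ (S.Z * S.T) + C * √(S.Z * S.T)) := by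
  obtain ⟨θ, hθ, h1, h2⟩ := exists_exponent hβ
  have hpos : (0 : ℝ) < 2 ^ (θ * β) := by positivity
  have hmax : max ((1 + 2 ^ (-θ)) / 2) (199 / 200) < ((2 : ℝ) ^ (θ * β))⁻¹ := by
    rw [max_lt_iff, lt_inv_comm₀ (by positivity) hpos, lt_inv_comm₀ (by norm_num) hpos,
      ← one_div, ← one_div, lt_div_iff₀ (by positivity), lt_div_iff₀ (by norm_num)]
    exact ⟨h1, h2⟩
  obtain ⟨ρ, hρ1, hρ2⟩ := exists_between hmax
  obtain ⟨hρa, hρb⟩ := max_lt_iff.1 hρ1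
  obtain ⟨x₀, hx₀, hx₀', hx⟩ := exists_logPot_two_mul_le (c := 1 + 2 ^ (-θ)) (ρ := 2 * ρ) hθ
    (by linarith)
  have hρ0 : 0 < ρ - 199 / 200 := by linarith
  have hC : 0 < ((ρ - 199 / 200) * √x₀)⁻¹ := by positivity
  refine ⟨θ, ρ, ((ρ - 199 / 200) * √x₀)⁻¹, hθ, by linarith, hC.le, ?_, fun S => ?_⟩
  · rwa [← one_div, lt_div_iff₀' hpos] at hρ2
  set C := ((ρ - 199 / 200) * √x₀)⁻¹ with hCdef
  have hs := mul_le_mul_of_nonneg_left S.sqrt_Z_mul_T_contract hC.le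
  rcases le_or_gt (S.Z * S.T) x₀ with h | h
  · have e := S.logPot_minus_add_plus hθ (by linarith)
    have e' := hx _ S.Z_mul_T_nonneg h
    have : 0 ≤ C * √(S.Z * S.T) * (ρ - 199 / 200) := by positivity
    linarith
  · have e1 := S.minus.logPot_le_one hθ
    have e2 := S.plus.logPot_le_one hθ
    have e3 := logPot_nonneg θ S.Z_mul_T_nonneg (by linarith [S.Z_mul_T_le])
    have e4 : 1 ≤ (ρ - 199 / 200) * (C * √(S.Z * S.T)) := by
      have : (ρ - 199 / 200) * (C * √x₀) = 1 := by
        rw [hCdef, mul_left_comm, mul_comm]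
        exact mul_inv_cancel₀ (by positivity)
      rw [← this]
      gcongr
    have e5 : 0 ≤ ρ * logPot θ (S.Z * S.T) := mul_nonneg (by linarith) e3
    linarith

/-! ### Polarization -/

lemma threshold_pos (β : ℝ) (n : ℕ) : 0 < threshold β n := by
  unfold threshold; positivity

lemma tendsto_two_pow_cast : Tendsto (fun n : ℕ => ((2 ^ n : ℕ) : ℝ)) atTop atTop :=
  tendsto_natCast_atTop_atTop.comp (tendsto_pow_atTop_atTop_of_one_lt (by norm_num))

lemma tendsto_threshold {β : ℝ} (hβ : 0 < β) : Tendsto (threshold β) atTop (𝓝 0) := by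
  unfold threshold
  exact (tendsto_rpow_atBot_of_base_gt_one 2 (by norm_num)).comp
    (tendsto_neg_atTop_atBot.comp ((tendsto_rpow_atTop hβ).comp tendsto_two_pow_cast))

open Classical in
/-- The indicator of a proposition, as a real number. -/
noncomputable def indic (Q : Prop) : ℝ := if Q then 1 else 0

lemma indic_pos {Q : Prop} (h : Q) : indic Q = 1 := if_pos h

lemma indic_neg {Q : Prop} (h : ¬Q) : indic Q = 0 := if_neg h

lemma indic_nonneg (Q : Prop) : 0 ≤ indic Q := by
  unfold indic; split_ifs <;> norm_num

lemma indic_le_one (Q : Prop) : indic Q ≤ 1 := by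
  unfold indic; split_ifs <;> norm_num

lemma indic_mono {Q R : Prop} (h : Q → R) : indic Q ≤ indic R := by
  by_cases hQ : Q
  · rw [indic_pos (h hQ)]; exact indic_le_one Q
  · rw [indic_neg hQ]; exact indic_nonneg R

/-- The proportion of sources at depth `n` with the property `Q`. -/
noncomputable def frac (n : ℕ) (Q : BitSource.{u, v} → Prop) (S : BitSource.{u, v}) : ℝ :=
  avg n (fun S => indic (Q S)) S

lemma frac_nonneg (n : ℕ) (Q : BitSource.{u, v} → Prop) (S : BitSource.{u, v}) :
    0 ≤ frac n Q S := by
  exact div_nonneg (Finset.sum_nonneg fun i _ => indic_nonneg _) (by positivity)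

lemma frac_mono (n : ℕ) {Q R : BitSource.{u, v} → Prop} (h : ∀ S, Q S → R S)
    (S : BitSource.{u, v}) : frac n Q S ≤ frac n R S :=
  avg_mono n (fun S => indic_mono (h S)) S

/-- Sources for which neither `Z` nor `T` is below the threshold are negligible. -/
lemma tendsto_frac_unpolarized {β : ℝ} (hβ0 : 0 < β) (hβ : β < 1 / 2) (S : BitSource.{u, v}) :
    Tendsto (fun n => frac n (fun S => threshold β n ≤ S.Z ∧ threshold β n ≤ S.T) S)
      atTop (𝓝 0) := by
  obtain ⟨θ, ρ, C, hθ, hρ, hC, hlt, hcontr⟩ := exists_potential.{u, v} hβ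
  set Φ : BitSource.{u, v} → ℝ := fun S => logPot θ (S.Z * S.T) + C * √(S.Z * S.T) with hΦ
  have hΦ0 (S : BitSource.{u, v}) : 0 ≤ Φ S :=
    add_nonneg (logPot_nonneg θ S.Z_mul_T_nonneg (by linarith [S.Z_mul_T_le])) (by positivity)
  have hbound (n : ℕ) : frac n (fun S => threshold β n ≤ S.Z ∧ threshold β n ≤ S.T) S
      ≤ 2 ^ θ * Φ S * (2 ^ (θ * β) * ρ) ^ n := by
    set M : ℝ := ((2 ^ n : ℕ) : ℝ) ^ β with hM
    have hM1 : 1 ≤ M := Real.one_le_rpow (by exact_mod_cast Nat.one_le_two_pow) hβ0.le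
    have hMθ : M ^ θ = (2 ^ (θ * β)) ^ n := by
      rw [hM, ← Real.rpow_mul (by positivity), Nat.cast_pow, Nat.cast_ofNat,
        ← Real.rpow_natCast, ← Real.rpow_natCast, ← Real.rpow_mul (by norm_num),
        ← Real.rpow_mul (by norm_num)]
      ring_nf
    have hpt (S : BitSource.{u, v}) :
        indic (threshold β n ≤ S.Z ∧ threshold β n ≤ S.T) ≤ (2 * M) ^ θ * Φ S := by
      by_cases h : threshold β n ≤ S.Z ∧ threshold β n ≤ S.T
      · rw [indic_pos h]
        have hδ := threshold_pos β n
        have hprod : threshold β n / 2 ≤ S.Z * S.T := by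
          rcases le_total S.Z S.T with h' | h'
          · nlinarith [S.one_le_Z_add_T]
          · nlinarith [S.one_le_Z_add_T]
        have e1 := logPot_mono hθ (by positivity) hprod (by linarith [S.Z_mul_T_le])
        have e2 : -Real.logb 2 (threshold β n / 2) = M + 1 := by
          rw [Real.logb_div hδ.ne' (by norm_num), Real.logb_self_eq_one (by norm_num), threshold,
            Real.logb_rpow (by norm_num) (by norm_num)]
          ring
        have e3 : (2 * M) ^ (-θ) ≤ logPot θ (threshold β n / 2) := by
          rw [logPot, e2]
          exact Real.rpow_le_rpow_of_nonpos (by positivity) (by linarith) (by linarith)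
        have e4 : (2 * M) ^ (-θ) ≤ Φ S := by
          have : 0 ≤ C * √(S.Z * S.T) := by positivity
          simp only [hΦ]
          linarith
        calc (1 : ℝ) = (2 * M) ^ θ * (2 * M) ^ (-θ) := by
              rw [← Real.rpow_add (by positivity), add_neg_cancel, Real.rpow_zero]
          _ ≤ _ := by gcongr
      · rw [indic_neg h]
        exact mul_nonneg (by positivity) (hΦ0 S)
    rw [frac]
    calc _ ≤ avg n (fun S => (2 * M) ^ θ * Φ S) S := avg_mono n hpt S
      _ = (2 * M) ^ θ * avg n Φ S := avg_const_mul _ _ _ _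
      _ ≤ (2 * M) ^ θ * (ρ ^ n * Φ S) := by
        gcongr
        exact avg_le_pow_mul hρ.le hcontr n S
      _ = 2 ^ θ * Φ S * (2 ^ (θ * β) * ρ) ^ n := by
        rw [Real.mul_rpow (by norm_num) (by positivity), hMθ, mul_pow]
        ring
  refine squeeze_zero (fun n => frac_nonneg _ _ _) hbound ?_
  simpa using (tendsto_pow_atTop_nhds_zero_of_lt_one (by positivity) hlt).const_mul (2 ^ θ * Φ S)

/-- A function that stays within distance `1` of the entropy, and is close to it on the sources
that are polarized with exponent `β`, has the conserved entropy as limiting average. -/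
lemma tendsto_avg_of_polarized {β : ℝ} (hβ0 : 0 < β) (hβ : β < 1 / 2)
    {φ : ℕ → BitSource.{u, v} → ℝ} (hle : ∀ n S, |φ n S - S.H| ≤ 1)
    (hext : ∀ᶠ n in atTop, ∀ S : BitSource.{u, v}, S.Z < threshold β n ∨ S.T < threshold β n →
      |φ n S - S.H| ≤ 4 * threshold β n) (S : BitSource.{u, v}) :
    Tendsto (fun n => avg n (φ n) S) atTop (𝓝 S.H) := by
  rw [tendsto_iff_dist_tendsto_zero]
  have hlim := ((tendsto_threshold hβ0).const_mul 4).add (tendsto_frac_unpolarized hβ0 hβ S)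
  rw [mul_zero, zero_add] at hlim
  refine squeeze_zero' (Eventually.of_forall fun n => dist_nonneg) ?_ hlim
  filter_upwards [hext] with n hn
  have hpt (S : BitSource.{u, v}) : |φ n S - S.H| ≤ 4 * threshold β n
      + indic (threshold β n ≤ S.Z ∧ threshold β n ≤ S.T) := by
    by_cases h : threshold β n ≤ S.Z ∧ threshold β n ≤ S.T
    · rw [indic_pos h]
      linarith [hle n S, threshold_pos β n]
    · rw [indic_neg h]
      rw [not_and_or, not_le, not_le] at h
      linarith [hn S h]
  have h1 := avg_mono n (fun S => show φ n S ≤ S.H + (4 * threshold β n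
      + indic (threshold β n ≤ S.Z ∧ threshold β n ≤ S.T)) by
    linarith [hpt S, le_abs_self (φ n S - S.H)]) S
  have h2 := avg_mono n (fun S => show S.H ≤ φ n S + (4 * threshold β n
      + indic (threshold β n ≤ S.Z ∧ threshold β n ≤ S.T)) by
    linarith [hpt S, neg_abs_le (φ n S - S.H)]) S
  rw [avg_add, avg_add, avg_const, avg_H] at h1 h2
  rw [Real.dist_eq, abs_le, frac]
  constructor <;> linarith

/-- A threshold with positive exponent is eventually below any threshold with smaller exponent
and below its complement, also when the latter exponent is negative. -/
lemma eventually_threshold_le {β β' : ℝ} (hβ' : 0 < β') (h : β ≤ β') :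
    ∀ᶠ n in atTop, threshold β' n ≤ threshold β n ∧ threshold β' n ≤ 1 - threshold β n := by
  have hN (n : ℕ) : (1 : ℝ) ≤ ((2 ^ n : ℕ) : ℝ) := by exact_mod_cast Nat.one_le_two_pow
  have h1 (n : ℕ) : threshold β' n ≤ threshold β n :=
    Real.rpow_le_rpow_of_exponent_le (by norm_num)
      (neg_le_neg (Real.rpow_le_rpow_of_exponent_le (hN n) h))
  rcases le_or_gt 0 β with hβ | hβ
  · refine Eventually.of_forall fun n => ⟨h1 n, ?_⟩
    have h2 : threshold β n ≤ 1 / 2 := by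
      have : threshold β n ≤ 2 ^ (-1 : ℝ) := Real.rpow_le_rpow_of_exponent_le (by norm_num)
        (neg_le_neg (Real.one_le_rpow (hN n) hβ))
      rwa [Real.rpow_neg_one, ← one_div] at this
    linarith [h1 n]
  · have hlim := (tendsto_rpow_mul_exp_neg_mul_atTop_nhds_zero (-β / β') (Real.log 2)
      (Real.log_pos (by norm_num))).comp ((tendsto_rpow_atTop hβ').comp tendsto_two_pow_cast)
    filter_upwards [hlim.eventually_lt_const (show (0 : ℝ) < 1 / 2 by norm_num)] with n hn
    refine ⟨h1 n, ?_⟩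
    have hN0 : (0 : ℝ) < ((2 ^ n : ℕ) : ℝ) := by linarith [hN n]
    have e1 : threshold β' n * ((2 ^ n : ℕ) : ℝ) ^ (-β) < 1 / 2 := by
      have e : threshold β' n = Real.exp (-Real.log 2 * ((2 ^ n : ℕ) : ℝ) ^ β') := by
        rw [threshold, Real.rpow_def_of_pos (by norm_num)]
        ring_nf
      simp only [Function.comp_apply] at hn
      rw [← Real.rpow_mul hN0.le, mul_div_cancel₀ _ hβ'.ne'] at hn
      rw [e, mul_comm]
      exact hn
    rw [Real.rpow_neg hN0.le, ← div_eq_mul_inv, div_lt_iff₀ (by positivity)] at e1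
    set a := ((2 ^ n : ℕ) : ℝ) ^ β with ha
    have ha0 : 0 ≤ a := by positivity
    have ha1 : a ≤ 1 := Real.rpow_le_one_of_one_le_of_nonpos (hN n) hβ.le
    have e2 : threshold β n ≤ 1 - a / 2 := by
      have := rpow_one_add_le_one_add_mul_self (s := -1 / 2) (by norm_num) ha0 ha1
      rw [threshold, ← ha, Real.rpow_neg (by norm_num), ← Real.inv_rpow (by norm_num)]
      norm_num at this ⊢
      linarith
    linarith

/-- The proportion of sources with small Bhattacharyya parameter tends to `1 - H`. -/
theorem tendsto_frac_low {β : ℝ} (hβ : β < 1 / 2) (S : BitSource.{u, v}) :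
    Tendsto (fun n => frac n (fun S => S.Z < threshold β n) S) atTop (𝓝 (1 - S.H)) := by
  have hβ0 : 0 < max β (1 / 4) := lt_max_of_lt_right (by norm_num)
  have key := tendsto_avg_of_polarized hβ0 (max_lt hβ (by norm_num))
    (φ := fun n S => 1 + (-1) * indic (S.Z < threshold β n)) (fun n S => by
      have := S.H_nonneg
      have := S.H_le_one
      have := indic_nonneg (S.Z < threshold β n)
      have := indic_le_one (S.Z < threshold β n)
      rw [abs_le]
      constructor <;> linarith) (by
      filter_upwards [eventually_threshold_le hβ0 (le_max_left β (1 / 4))] with n hn S hS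
      have h0 := S.H_nonneg
      have h1 := S.H_le_one
      rcases hS with hS | hS
      · rw [indic_pos (hS.trans_le hn.1), abs_le]
        constructor <;> linarith [S.H_le_mul_Z]
      · rw [indic_neg (by linarith [S.one_le_Z_add_T]), abs_le]
        constructor <;> linarith [S.one_sub_H_le_mul_T, threshold_pos (max β (1 / 4)) n]) S
  have := key.const_sub 1
  simp only [avg_add, avg_const_mul, avg_const] at this
  exact this.congr fun n => by rw [frac]; ring

/-- The proportion of sources with Bhattacharyya parameter close to `1` tends to `H`. -/
theorem tendsto_frac_high {β : ℝ} (hβ : β < 1 / 2) (S : BitSource.{u, v}) :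
    Tendsto (fun n => frac n (fun S => 1 - threshold β n < S.Z) S) atTop (𝓝 S.H) := by
  have hβ0 : 0 < max β (1 / 4) := lt_max_of_lt_right (by norm_num)
  refine tendsto_avg_of_polarized hβ0 (max_lt hβ (by norm_num))
    (φ := fun n S => indic (1 - threshold β n < S.Z)) (fun n S => ?_) ?_ S
  · have := S.H_nonneg
    have := S.H_le_one
    have := indic_nonneg (1 - threshold β n < S.Z)
    have := indic_le_one (1 - threshold β n < S.Z)
    rw [abs_le]
    constructor <;> linarith
  · filter_upwards [eventually_threshold_le hβ0 (le_max_left β (1 / 4))] with n hn S hS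
    have h0 := S.H_nonneg
    have h1 := S.H_le_one
    rcases hS with hS | hS
    · rw [indic_neg (by linarith), abs_le]
      constructor <;> linarith [S.H_le_mul_Z]
    · rw [indic_pos (by linarith [S.one_le_Z_add_T]), abs_le]
      constructor <;> linarith [S.one_sub_H_le_mul_T, threshold_pos (max β (1 / 4)) n]

/-- Sources whose Bhattacharyya parameter is at neither extreme are negligible. -/
theorem tendsto_frac_middle {β : ℝ} (hβ0 : 0 < β) (hβ : β < 1 / 2) (S : BitSource.{u, v}) :
    Tendsto (fun n => frac n (fun S => threshold β n ≤ S.Z ∧ S.Z ≤ 1 - threshold β n) S)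
      atTop (𝓝 0) :=
  squeeze_zero (fun _ => frac_nonneg _ _ _)
    (fun n => frac_mono n (fun S h => ⟨h.1, by linarith [S.one_le_Z_add_T, h.2]⟩) S)
    (tendsto_frac_unpolarized hβ0 hβ S)

/-! ### The polar transform of a vector -/

lemma kernelF_mul_self : kernelF * kernelF = 1 := by
  unfold kernelF; decide

lemma kronPow_mul_self (n : ℕ) : kronPow n * kronPow n = 1 := by
  induction n with
  | zero => simp [kronPow]
  | succ n ih =>
    rw [kronPow, Matrix.reindex_apply, Matrix.submatrix_mul_equiv, ← Matrix.mul_kronecker_mul, ih,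
      kernelF_mul_self, Matrix.one_kronecker_one, Matrix.submatrix_one_equiv]

lemma vecMul_kronPow_injective (n : ℕ) :
    Function.Injective fun x : Fin (2 ^ n) → ZMod 2 => x ᵥ* kronPow n :=
  Function.LeftInverse.injective (g := fun x => x ᵥ* kronPow n) fun x => by
    simp [Matrix.vecMul_vecMul, kronPow_mul_self]

lemma vecMul_kronPow_succ (n : ℕ) (x : Fin (2 ^ (n + 1)) → ZMod 2) (b : Fin 2) (j : Fin (2 ^ n)) :
    (x ᵥ* kronPow (n + 1)) (kronIndex n (b, j)) = kernelF 0 b *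
      ((fun t => x (kronIndex n (0, t))) ᵥ* kronPow n) j + kernelF 1 b *
      ((fun t => x (kronIndex n (1, t))) ᵥ* kronPow n) j := by
  simp only [Matrix.vecMul, dotProduct]
  rw [← (kronIndex n).sum_comp, Fintype.sum_prod_type, Fin.sum_univ_two, Finset.mul_sum,
    Finset.mul_sum]
  congr 1 <;>
  · refine Finset.sum_congr rfl fun t _ => ?_
    simp [kronPow]
    ring

lemma vecMul_kronPow_zero_half (n : ℕ) (x : Fin (2 ^ (n + 1)) → ZMod 2) (j : Fin (2 ^ n)) :
    (x ᵥ* kronPow (n + 1)) (kronIndex n (0, j)) =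
      ((fun t => x (kronIndex n (0, t)) + x (kronIndex n (1, t))) ᵥ* kronPow n) j := by
  rw [vecMul_kronPow_succ]
  have := Matrix.add_vecMul (kronPow n) (fun t => x (kronIndex n (0, t)))
    (fun t => x (kronIndex n (1, t)))
  simp only [kernelF, Pi.add_def] at this ⊢
  rw [this]
  simp

lemma vecMul_kronPow_one_half (n : ℕ) (x : Fin (2 ^ (n + 1)) → ZMod 2) (j : Fin (2 ^ n)) :
    (x ᵥ* kronPow (n + 1)) (kronIndex n (1, j)) =
      ((fun t => x (kronIndex n (1, t))) ᵥ* kronPow n) j := by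
  rw [vecMul_kronPow_succ]
  simp [kernelF]

lemma kronIndex_lt_iff (n : ℕ) (b c : Fin 2) (j k : Fin (2 ^ n)) :
    kronIndex n (b, j) < kronIndex n (c, k) ↔ b < c ∨ b = c ∧ j < k := by
  rw [Fin.lt_def]
  simp only [kronIndex, Equiv.trans_apply, finProdFinEquiv_apply_val, finCongr_apply,
    Fin.val_cast]
  have := j.isLt
  have := k.isLt
  fin_cases b <;> fin_cases c <;> simp <;> omega

lemma forall_kronIndex {n : ℕ} {Q : Fin (2 ^ (n + 1)) → Prop} :
    (∀ l, Q l) ↔ (∀ j, Q (kronIndex n (0, j))) ∧ ∀ j, Q (kronIndex n (1, j)) := by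
  rw [(kronIndex n).surjective.forall, Prod.forall, Fin.forall_fin_two]

/-- A block of length `2 ^ (n + 1)` as a block of `2 ^ n` pairs. -/
def pairEquiv (Ω : Type u) (n : ℕ) : (Fin (2 ^ (n + 1)) → Ω) ≃ (Fin (2 ^ n) → Ω × Ω) where
  toFun ω t := (ω (kronIndex n (0, t)), ω (kronIndex n (1, t)))
  invFun ω i := if ((kronIndex n).symm i).1 = 0 then (ω ((kronIndex n).symm i).2).1
    else (ω ((kronIndex n).symm i).2).2
  left_inv ω := by
    funext i
    obtain ⟨⟨b, j⟩, rfl⟩ := (kronIndex n).surjective i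
    fin_cases b <;> simp
  right_inv ω := by
    funext t
    simp

lemma iidLaw_pairEquiv {Ω : Type u} (p : Ω → ℝ) (n : ℕ) (ω : Fin (2 ^ (n + 1)) → Ω) :
    iidLaw (fun z : Ω × Ω => p z.1 * p z.2) (2 ^ n) (pairEquiv Ω n ω) =
      iidLaw p (2 ^ (n + 1)) ω := by
  rw [iidLaw, iidLaw, ← (kronIndex n).prod_comp, Fintype.prod_prod_type, Fin.prod_univ_two,
    ← Finset.prod_mul_distrib]
  rfl

namespace BitSource

/-- The transform of the bits of `2 ^ n` independent copies of a source. -/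
def transform (S : BitSource.{u, v}) (n : ℕ) (ω : Fin (2 ^ n) → S.Ω) : Fin (2 ^ n) → ZMod 2 :=
  (fun t => S.A (ω t)) ᵥ* kronPow n

/-- The transformed bits before position `i` and all side informations. -/
def past (S : BitSource.{u, v}) (n : ℕ) (i : Fin (2 ^ n)) (ω : Fin (2 ^ n) → S.Ω) :
    ({j : Fin (2 ^ n) // j < i} → ZMod 2) × (Fin (2 ^ n) → S.γ) :=
  (fun j => S.transform n ω j, fun t => S.B (ω t))

lemma past_eq_iff (S : BitSource.{u, v}) (n : ℕ) (i : Fin (2 ^ n)) (ω ω' : Fin (2 ^ n) → S.Ω) :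
    S.past n i ω = S.past n i ω' ↔
      (∀ j, j < i → S.transform n ω j = S.transform n ω' j) ∧ ∀ t, S.B (ω t) = S.B (ω' t) := by
  simp [past, Prod.ext_iff, funext_iff]

/-- A block of `2 ^ (n + 1)` outcomes for `S` as a block of `2 ^ n` outcomes for `S.minus`. -/
def minusEquiv (S : BitSource.{u, v}) (n : ℕ) :
    (Fin (2 ^ (n + 1)) → S.Ω) ≃ (Fin (2 ^ n) → S.minus.Ω) :=
  pairEquiv S.Ω n

/-- A block of `2 ^ (n + 1)` outcomes for `S` as a block of `2 ^ n` outcomes for `S.plus`. -/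
def plusEquiv (S : BitSource.{u, v}) (n : ℕ) :
    (Fin (2 ^ (n + 1)) → S.Ω) ≃ (Fin (2 ^ n) → S.plus.Ω) :=
  pairEquiv S.Ω n

lemma minus_B_eq_iff (S : BitSource.{u, v}) (n : ℕ) (ω ω' : Fin (2 ^ (n + 1)) → S.Ω)
    (t : Fin (2 ^ n)) :
    S.minus.B (S.minusEquiv n ω t) = S.minus.B (S.minusEquiv n ω' t) ↔
      S.B (ω (kronIndex n (0, t))) = S.B (ω' (kronIndex n (0, t))) ∧
      S.B (ω (kronIndex n (1, t))) = S.B (ω' (kronIndex n (1, t))) :=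
  Prod.mk_inj

lemma plus_B_eq_iff (S : BitSource.{u, v}) (n : ℕ) (ω ω' : Fin (2 ^ (n + 1)) → S.Ω)
    (t : Fin (2 ^ n)) :
    S.plus.B (S.plusEquiv n ω t) = S.plus.B (S.plusEquiv n ω' t) ↔
      S.A (ω (kronIndex n (0, t))) + S.A (ω (kronIndex n (1, t)))
        = S.A (ω' (kronIndex n (0, t))) + S.A (ω' (kronIndex n (1, t))) ∧
      S.B (ω (kronIndex n (0, t))) = S.B (ω' (kronIndex n (0, t))) ∧
      S.B (ω (kronIndex n (1, t))) = S.B (ω' (kronIndex n (1, t))) :=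
  Prod.mk_inj.trans (and_congr_right fun _ => Prod.mk_inj)

lemma transform_minus (S : BitSource.{u, v}) (n : ℕ) (ω : Fin (2 ^ (n + 1)) → S.Ω)
    (j : Fin (2 ^ n)) :
    S.minus.transform n (S.minusEquiv n ω) j = S.transform (n + 1) ω (kronIndex n (0, j)) :=
  (vecMul_kronPow_zero_half n (fun t => S.A (ω t)) j).symm

lemma transform_plus (S : BitSource.{u, v}) (n : ℕ) (ω : Fin (2 ^ (n + 1)) → S.Ω)
    (j : Fin (2 ^ n)) :
    S.plus.transform n (S.plusEquiv n ω) j = S.transform (n + 1) ω (kronIndex n (1, j)) :=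
  (vecMul_kronPow_one_half n (fun t => S.A (ω t)) j).symm

lemma past_minus_eq_iff (S : BitSource.{u, v}) (n : ℕ) (j : Fin (2 ^ n))
    (ω ω' : Fin (2 ^ (n + 1)) → S.Ω) :
    S.minus.past n j (S.minusEquiv n ω) = S.minus.past n j (S.minusEquiv n ω') ↔
      S.past (n + 1) (kronIndex n (0, j)) ω = S.past (n + 1) (kronIndex n (0, j)) ω' := by
  rw [past_eq_iff, past_eq_iff]
  simp only [transform_minus]
  rw [forall_kronIndex, forall_kronIndex (Q := fun t => S.B (ω t) = S.B (ω' t))]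
  simp [kronIndex_lt_iff, minus_B_eq_iff, forall_and]

/-- The transformed bits of the first half determine, because the transform is invertible, the
sums of the pairs of bits, which are part of the side information of `plus`. -/
lemma past_plus_eq_iff (S : BitSource.{u, v}) (n : ℕ) (j : Fin (2 ^ n))
    (ω ω' : Fin (2 ^ (n + 1)) → S.Ω) :
    S.plus.past n j (S.plusEquiv n ω) = S.plus.past n j (S.plusEquiv n ω') ↔
      S.past (n + 1) (kronIndex n (1, j)) ω = S.past (n + 1) (kronIndex n (1, j)) ω' := by
  rw [past_eq_iff, past_eq_iff]
  have hinj : (∀ k, S.transform (n + 1) ω (kronIndex n (0, k))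
      = S.transform (n + 1) ω' (kronIndex n (0, k))) ↔
      ∀ t, S.A (ω (kronIndex n (0, t))) + S.A (ω (kronIndex n (1, t)))
        = S.A (ω' (kronIndex n (0, t))) + S.A (ω' (kronIndex n (1, t))) := by
    simp only [← transform_minus, ← funext_iff]
    exact (vecMul_kronPow_injective n).eq_iff
  simp only [transform_plus]
  rw [forall_kronIndex, forall_kronIndex (Q := fun t => S.B (ω t) = S.B (ω' t))]
  simp only [kronIndex_lt_iff]
  simp only [Fin.zero_lt_one, true_or, forall_const, hinj]
  simp [plus_B_eq_iff, forall_and]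
  tauto

/-- The sources at depth `n` of the tree describe the transformed bits given their past. -/
theorem bhattacharyya_transform (S : BitSource.{u, v}) (n : ℕ) (i : Fin (2 ^ n)) :
    bhattacharyya (iidLaw S.p (2 ^ n)) (fun ω => S.transform n ω i) (S.past n i)
      = (node n S i).Z := by
  induction n generalizing S with
  | zero =>
    have hi (j : Fin (2 ^ 0)) : j = i := Subsingleton.elim (α := Fin 1) j i
    let e : S.Ω ≃ (Fin (2 ^ 0) → S.Ω) := (Equiv.funUnique (Fin 1) S.Ω).symm
    refine bhattacharyya_congr e (fun ω => ?_) (fun ω => ?_) (fun ω ω' => ?_)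
    · exact Fin.prod_univ_one (fun t => S.p (e ω t))
    · simp only [transform, kronPow, Matrix.vecMul_one]
      rfl
    · rw [past_eq_iff]
      have : ∀ j : Fin (2 ^ 0), ¬ j < i := fun j => by rw [hi j]; exact lt_irrefl i
      simp only [this, false_imp_iff, implies_true, true_and]
      exact ⟨fun h => h i, fun h _ => h⟩
  | succ n ih =>
    obtain ⟨⟨b, j⟩, rfl⟩ := (kronIndex n).surjective i
    obtain rfl | rfl : b = 0 ∨ b = 1 := by omega
    · rw [node_zero, ← ih]
      exact (bhattacharyya_congr (S.minusEquiv n) (iidLaw_pairEquiv S.p n)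
        (fun ω => S.transform_minus n ω j) (S.past_minus_eq_iff n j)).symm
    · rw [node_one, ← ih]
      exact (bhattacharyya_congr (S.plusEquiv n) (iidLaw_pairEquiv S.p n)
        (fun ω => S.transform_plus n ω j) (S.past_plus_eq_iff n j)).symm

end BitSource

/-! ### Entropy and its chain rule -/

section Entropy

variable {Ω α α' γ : Type*} [Fintype Ω]

/-- The Shannon entropy of a random variable, in bits, as the expected logarithm of the inverse
probability. -/
noncomputable def entropy (p : Ω → ℝ) (C : Ω → α) : ℝ :=
  -∑ ω, p ω * Real.logb 2 (law p C (C ω))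

lemma entropy_congr (p : Ω → ℝ) {C : Ω → α} {C' : Ω → α'}
    (h : ∀ ω ω', C ω = C ω' ↔ C' ω = C' ω') : entropy p C = entropy p C' := by
  unfold entropy
  congr 1
  refine Finset.sum_congr rfl fun ω _ => ?_
  rw [law_congr fun ω' => h ω' ω]

lemma entropy_eq_sum_negMulLog [Fintype α] (p : Ω → ℝ) (C : Ω → α) :
    entropy p C = (∑ c, Real.negMulLog (law p C c)) / Real.log 2 := by
  rw [entropy, ← sum_law_mul p C fun c => Real.logb 2 (law p C c), ← Finset.sum_neg_distrib,
    Finset.sum_div]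
  refine Finset.sum_congr rfl fun c _ => ?_
  rw [Real.negMulLog, Real.logb]
  ring

lemma entropy_const {p : Ω → ℝ} (hp : ∑ ω, p ω = 1) (c : α) : entropy p (fun _ => c) = 0 := by
  have : law p (fun _ => c) c = 1 := by simp [law, hp]
  simp [entropy, this]

lemma mutualInfo_eq [Fintype α] [Fintype γ] {p : Ω → ℝ} (hp : ∀ ω, 0 ≤ p ω) (A : Ω → α)
    (B : Ω → γ) :
    mutualInfo p A B = entropy p A + entropy p B - entropy p fun ω => (A ω, B ω) := by
  rw [mutualInfo, ← Fintype.sum_prod_type', sum_law_mul p (fun ω => (A ω, B ω)) fun x =>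
    Real.logb 2 (law p (fun ω => (A ω, B ω)) (x.1, x.2) / (law p A x.1 * law p B x.2))]
  unfold entropy
  rw [sub_neg_eq_add, ← Finset.sum_neg_distrib, ← Finset.sum_neg_distrib, ← Finset.sum_add_distrib,
    ← Finset.sum_add_distrib]
  refine Finset.sum_congr rfl fun ω _ => ?_
  rcases (hp ω).eq_or_lt with h | h
  · simp [← h]
  have h1 := law_pos hp A h
  have h2 := law_pos hp B h
  have h3 := law_pos hp (fun ω => (A ω, B ω)) h
  rw [Real.logb_div h3.ne' (by positivity), Real.logb_mul h1.ne' h2.ne']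
  ring

lemma BitSource.H_eq_entropy_sub (S : BitSource.{u, v}) :
    S.H = entropy S.p (fun ω => (S.A ω, S.B ω)) - entropy S.p S.B := by
  rw [entropy_eq_sum_negMulLog, entropy_eq_sum_negMulLog, ← sub_div, BitSource.H]
  congr 1
  rw [Fintype.sum_prod_type, sum_zmod_two, ← Finset.sum_add_distrib, ← Finset.sum_sub_distrib]
  refine Finset.sum_congr rfl fun b _ => ?_
  rw [S.joint_add_joint]
  rfl

end Entropy

/-! ### The levels of the label as binary sources -/

section Levels

variable {𝒳 : Type u} {𝒴 : Type v} {δ : Type w} {m : ℕ} [Fintype 𝒳] [Fintype 𝒴] [Fintype δ]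

lemma sum_toReal_pmf {α : Type*} [Fintype α] (P : PMF α) : ∑ a, (P a).toReal = 1 := by
  rw [← ENNReal.toReal_sum fun a _ => P.apply_ne_top a, ← tsum_fintype (L := .unconditional α),
    P.tsum_coe, ENNReal.toReal_one]

omit [Fintype 𝒳] [Fintype 𝒴] in
lemma jointLaw_nonneg (P : PMF 𝒳) (W : 𝒳 → PMF 𝒴) (z : 𝒳 × 𝒴) : 0 ≤ jointLaw P W z :=
  mul_nonneg ENNReal.toReal_nonneg ENNReal.toReal_nonneg

lemma sum_jointLaw (P : PMF 𝒳) (W : 𝒳 → PMF 𝒴) : ∑ z, jointLaw P W z = 1 := by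
  simp only [jointLaw, Fintype.sum_prod_type, ← Finset.mul_sum, sum_toReal_pmf, mul_one]

/-- The `ℓ`-th label bit of the channel input, given the lower label bits and a further function
`V` of the input and the output. Constant `V` gives the source without, and `V = Prod.snd` the
source with knowledge of the channel output. -/
noncomputable def levelSource (P : PMF 𝒳) (W : 𝒳 → PMF 𝒴) (f : (Fin m → ZMod 2) ≃ 𝒳)
    (V : 𝒳 × 𝒴 → δ) (ℓ : Fin m) : BitSource.{max u v, w} where
  Ω := 𝒳 × 𝒴
  γ := ({k : Fin m // k < ℓ} → ZMod 2) × δ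
  p := jointLaw P W
  A z := f.symm z.1 ℓ
  B z := (fun k => f.symm z.1 k, V z)
  nonneg := jointLaw_nonneg P W
  total := sum_jointLaw P W

variable (P : PMF 𝒳) (W : 𝒳 → PMF 𝒴) (f : (Fin m → ZMod 2) ≃ 𝒳)

/-- The entropies of the levels telescope to the entropy of the channel input given `V`. -/
lemma sum_H_levelSource (V : 𝒳 × 𝒴 → δ) :
    ∑ ℓ, (levelSource P W f V ℓ).H
      = entropy (jointLaw P W) (fun z => (z.1, V z)) - entropy (jointLaw P W) V := by
  set E : ℕ → ℝ := fun j => entropy (jointLaw P W)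
    (fun z => ((fun k : {k : Fin m // k.val < j} => f.symm z.1 k), V z)) with hE
  have h (ℓ : Fin m) : (levelSource P W f V ℓ).H = E (ℓ + 1) - E ℓ := by
    rw [BitSource.H_eq_entropy_sub]
    congr 1
    refine entropy_congr _ fun z z' => ?_
    simp only [levelSource, Prod.mk.injEq, funext_iff, Subtype.forall, Nat.lt_succ_iff_lt_or_eq,
      Fin.lt_def]
    constructor
    · rintro ⟨h1, h2, h3⟩
      refine ⟨fun k hk => hk.elim (h2 k) fun hk => ?_, h3⟩
      rw [Fin.ext hk, h1]
    · rintro ⟨h1, h2⟩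
      exact ⟨h1 ℓ (Or.inr rfl), fun k hk => h1 k (Or.inl hk), h2⟩
  simp_rw [h]
  rw [Fin.sum_univ_eq_sum_range fun j => E (j + 1) - E j, Finset.sum_range_sub]
  congr 1
  · refine entropy_congr _ fun z z' => ?_
    simp only [Prod.mk.injEq]
    refine and_congr_left fun _ => ⟨fun h => f.symm.injective (funext fun k => ?_), fun h => ?_⟩
    · exact congrFun h ⟨k, k.isLt⟩
    · rw [h]
  · refine entropy_congr _ fun z z' => ?_
    simp [funext_iff]

lemma sum_H_sub_sum_H :
    ∑ ℓ, (levelSource P W f (fun _ => ()) ℓ).H - ∑ ℓ, (levelSource P W f Prod.snd ℓ).H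
      = channelInfo P W := by
  rw [sum_H_levelSource, sum_H_levelSource, channelInfo, mutualInfo_eq (jointLaw_nonneg P W),
    entropy_const (sum_jointLaw P W),
    entropy_congr (jointLaw P W) (C := fun z => (z.1, ())) (C' := Prod.fst) (by simp)]
  ring

omit [Fintype 𝒳] [Fintype 𝒴] in
/-- The bit reversal merely permutes the independent copies. -/
lemma polarBits_eq (n : ℕ) (ℓ : Fin m) (ω : Fin (2 ^ n) → 𝒳 × 𝒴) :
    polarBits f n ℓ ω = (fun t => f.symm (ω ((bitReversal n).symm t)).1 ℓ) ᵥ* kronPow n := by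
  rw [polarBits, polarMatrix, ← Matrix.vecMul_vecMul, Matrix.vecMul_permMatrix]
  rfl

lemma bhattacharyya_eq_Z_node {γ : Type*} [Fintype γ] (V : 𝒳 × 𝒴 → δ) (n : ℕ) (ℓ : Fin m)
    (i : Fin (2 ^ n)) (B : (Fin (2 ^ n) → 𝒳 × 𝒴) → γ)
    (hB : ∀ ω ω', B ω = B ω' ↔
      sideInfo f n ℓ i ω = sideInfo f n ℓ i ω' ∧ ∀ t, V (ω t) = V (ω' t)) :
    bhattacharyya (iidLaw (jointLaw P W) (2 ^ n)) (fun ω => polarBits f n ℓ ω i) B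
      = (node n (levelSource P W f V ℓ) i).Z := by
  rw [← BitSource.bhattacharyya_transform]
  let σ := (bitReversal n).symm
  let e : (Fin (2 ^ n) → 𝒳 × 𝒴) ≃ (Fin (2 ^ n) → (levelSource P W f V ℓ).Ω) :=
    σ.symm.arrowCongr (Equiv.refl (𝒳 × 𝒴))
  have he (ω : Fin (2 ^ n) → 𝒳 × 𝒴) (t) : e ω t = ω (σ t) := rfl
  have htr (ω : Fin (2 ^ n) → 𝒳 × 𝒴) :
      (levelSource P W f V ℓ).transform n (e ω) = polarBits f n ℓ ω :=
    (polarBits_eq f n ℓ ω).symm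
  refine (bhattacharyya_congr e (fun ω => ?_) (fun ω => ?_) fun ω ω' => ?_).symm
  · exact Equiv.prod_comp σ fun t => jointLaw P W (ω t)
  · rw [htr]
  · rw [hB, BitSource.past_eq_iff, htr, htr]
    simp only [he]
    rw [σ.surjective.forall (p := fun t => V (ω t) = V (ω' t))]
    simp only [levelSource, sideInfo, bitLevel, Prod.mk.injEq, funext_iff, Subtype.forall,
      forall_and, and_assoc]
    refine and_congr_right fun _ => and_congr_left fun _ => ?_
    constructor
    · exact fun h k hk => σ.surjective.forall.2 fun t => h t k hk
    · exact fun h t k hk => h k hk (σ t)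

lemma zU_eq_Z_node (n : ℕ) (ℓ : Fin m) (i : Fin (2 ^ n)) :
    zU P W f n ℓ i = (node n (levelSource P W f (fun _ => ()) ℓ) i).Z :=
  bhattacharyya_eq_Z_node P W f _ n ℓ i _ (by simp)

lemma zUY_eq_Z_node (n : ℕ) (ℓ : Fin m) (i : Fin (2 ^ n)) :
    zUY P W f n ℓ i = (node n (levelSource P W f Prod.snd ℓ) i).Z :=
  bhattacharyya_eq_Z_node P W f _ n ℓ i _ (by simp [outputs, funext_iff])

lemma zUY_le_zU (n : ℕ) (ℓ : Fin m) (i : Fin (2 ^ n)) : zUY P W f n ℓ i ≤ zU P W f n ℓ i :=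
  bhattacharyya_pair_le (fun ω => Finset.prod_nonneg fun t _ => jointLaw_nonneg P W (ω t)) _ _ _

end Levels

/-! ### Counting the positions -/

lemma card_eq_sum_indic {α : Type*} [Fintype α] (s : Finset α) :
    (s.card : ℝ) = ∑ a, indic (a ∈ s) := by
  simp only [indic, Finset.sum_boole]
  congr 2
  ext a
  simp

lemma sum_indic_div_eq {m : ℕ} (S : Fin m → BitSource.{u, v}) (n : ℕ)
    (Q : BitSource.{u, v} → Prop) :
    (∑ a : Fin m × Fin (2 ^ n), indic (Q (node n (S a.1) a.2))) / 2 ^ n = ∑ ℓ, frac n Q (S ℓ) := by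
  rw [Fintype.sum_prod_type, Finset.sum_div]
  rfl

/-- Here `x` and `y` are the Bhattacharyya parameters of a position without and with the channel
output. A position that is counted twice in the union has a parameter away from the extremes with
respect to the smaller threshold `η`. -/
lemma abs_indic_union_sub_le {x y δ η : ℝ} (hyx : y ≤ x) (hη : η ≤ 1 - δ) :
    |indic (x < δ ∨ 1 - δ < y) - (indic (x < δ) + indic (1 - δ < y))|
      ≤ indic (η ≤ x ∧ x ≤ 1 - η) + indic (η ≤ y ∧ y ≤ 1 - η) := by
  have h1 := indic_nonneg (η ≤ x ∧ x ≤ 1 - η)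
  have h2 := indic_nonneg (η ≤ y ∧ y ≤ 1 - η)
  by_cases hx : x < δ <;> by_cases hy : 1 - δ < y <;>
    simp only [hx, hy, indic_pos, indic_neg, true_or, or_true, or_self, not_false_eq_true]
  · rw [indic_pos (Q := η ≤ x ∧ x ≤ 1 - η) ⟨by linarith, by linarith⟩]
    norm_num
    exact h2
  all_goals norm_num; linarith

/-- The data set is the complement of the union, except for positions with a parameter away from
the extremes. -/
lemma abs_indic_data_sub_le {x y δ η : ℝ} (hη : η ≤ δ) (hη' : η ≤ 1 - δ) :
    |indic (1 - δ < x ∧ y < δ) - (1 - indic (x < δ ∨ 1 - δ < y))|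
      ≤ indic (η ≤ x ∧ x ≤ 1 - η) + indic (η ≤ y ∧ y ≤ 1 - η) := by
  have h1 := indic_nonneg (η ≤ x ∧ x ≤ 1 - η)
  have h2 := indic_nonneg (η ≤ y ∧ y ≤ 1 - η)
  by_cases hd : 1 - δ < x ∧ y < δ <;> by_cases hu : x < δ ∨ 1 - δ < y
  · rw [indic_pos hd, indic_pos hu]
    have : 1 ≤ indic (η ≤ x ∧ x ≤ 1 - η) + indic (η ≤ y ∧ y ≤ 1 - η) := by
      rcases hu with hu | hu
      · rw [indic_pos (Q := η ≤ x ∧ x ≤ 1 - η) ⟨by linarith [hd.1], by linarith⟩]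
        linarith
      · rw [indic_pos (Q := η ≤ y ∧ y ≤ 1 - η) ⟨by linarith, by linarith [hd.2]⟩]
        linarith
    norm_num
    linarith
  · rw [indic_pos hd, indic_neg hu]
    norm_num
    linarith
  · rw [indic_neg hd, indic_pos hu]
    norm_num
    linarith
  · rw [indic_neg hd, indic_neg hu]
    have : 1 ≤ indic (η ≤ x ∧ x ≤ 1 - η) + indic (η ≤ y ∧ y ≤ 1 - η) := by
      rw [not_or, not_lt, not_lt] at hu
      rw [not_and_or, not_lt, not_lt] at hd
      rcases hd with hd | hd
      · rw [indic_pos (Q := η ≤ x ∧ x ≤ 1 - η) ⟨by linarith [hu.1], by linarith⟩]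
        linarith
      · rw [indic_pos (Q := η ≤ y ∧ y ≤ 1 - η) ⟨by linarith, by linarith [hu.2]⟩]
        linarith
    norm_num
    linarith

lemma tendsto_of_abs_sum_sub_le {ι : ℕ → Type*} [∀ n, Fintype (ι n)] {φ ψ b : ∀ n, ι n → ℝ}
    {L : ℝ} (h : ∀ᶠ n in atTop, ∀ a, |φ n a - ψ n a| ≤ b n a)
    (hb : Tendsto (fun n => (∑ a, b n a) / (2 : ℝ) ^ n) atTop (𝓝 0))
    (hψ : Tendsto (fun n => (∑ a, ψ n a) / (2 : ℝ) ^ n) atTop (𝓝 L)) :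
    Tendsto (fun n => (∑ a, φ n a) / (2 : ℝ) ^ n) atTop (𝓝 L) := by
  have : Tendsto (fun n => (∑ a, φ n a) / (2 : ℝ) ^ n - (∑ a, ψ n a) / (2 : ℝ) ^ n) atTop
      (𝓝 0) := by
    refine squeeze_zero_norm' ?_ hb
    filter_upwards [h] with n hn
    rw [← sub_div, ← Finset.sum_sub_distrib, Real.norm_eq_abs, abs_div, abs_of_pos (by positivity :
      (0 : ℝ) < 2 ^ n)]
    gcongr
    exact (Finset.abs_sum_le_sum_abs _ _).trans (Finset.sum_le_sum fun a _ => hn a)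
  simpa using this.add hψ

end MultilevelPolar

open MultilevelPolar in
theorem theorem1 {𝒳 𝒴 : Type*} [Fintype 𝒳] [Fintype 𝒴] (m : ℕ)
    (f : (Fin m → ZMod 2) ≃ 𝒳) (P : PMF 𝒳) (W : 𝒳 → PMF 𝒴) (β : ℝ) (hβ : β < 1 / 2) :
    Tendsto
      (fun n : ℕ =>
        (((MultilevelPolar.lowU P W f β n ∪ MultilevelPolar.highUY P W f β n).card : ℕ) : ℝ)
          / (2 : ℝ) ^ n)
      atTop (𝓝 ((m : ℝ) - MultilevelPolar.channelInfo P W)) ∧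
    Tendsto
      (fun n : ℕ => ((MultilevelPolar.dataSet P W f β n).card : ℝ) / (2 : ℝ) ^ n)
      atTop (𝓝 (MultilevelPolar.channelInfo P W)) := by
  set SU := levelSource P W f (fun _ => ()) with hSU
  set SY := levelSource P W f Prod.snd with hSY
  -- The estimates for exceptional positions need a positive exponent, also if `β` is not positive.
  set β' := max β (1 / 4) with hβ'
  have hβ0 : 0 < β' := lt_max_of_lt_right (by norm_num)
  have hβ1 : β' < 1 / 2 := max_lt hβ (by norm_num)
  have hbad : Tendsto (fun n : ℕ => (∑ a : Fin m × Fin (2 ^ n),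
      (indic (threshold β' n ≤ zU P W f n a.1 a.2 ∧ zU P W f n a.1 a.2 ≤ 1 - threshold β' n)
        + indic (threshold β' n ≤ zUY P W f n a.1 a.2 ∧
          zUY P W f n a.1 a.2 ≤ 1 - threshold β' n))) / (2 : ℝ) ^ n) atTop (𝓝 0) := by
    have h1 := tendsto_finsetSum Finset.univ fun ℓ _ => tendsto_frac_middle hβ0 hβ1 (SU ℓ)
    have h2 := tendsto_finsetSum Finset.univ fun ℓ _ => tendsto_frac_middle hβ0 hβ1 (SY ℓ)
    have h := h1.add h2
    simp only [Finset.sum_const_zero, add_zero] at h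
    refine h.congr fun n => ?_
    simp only [zU_eq_Z_node, zUY_eq_Z_node]
    rw [Finset.sum_add_distrib, add_div, ← sum_indic_div_eq, ← sum_indic_div_eq]
  have hsum : Tendsto (fun n : ℕ => (∑ a : Fin m × Fin (2 ^ n),
      (indic (zU P W f n a.1 a.2 < threshold β n)
        + indic (1 - threshold β n < zUY P W f n a.1 a.2))) / (2 : ℝ) ^ n) atTop
      (𝓝 ((m : ℝ) - channelInfo P W)) := by
    have h1 := tendsto_finsetSum Finset.univ fun ℓ _ => tendsto_frac_low hβ (SU ℓ)
    have h2 := tendsto_finsetSum Finset.univ fun ℓ _ => tendsto_frac_high hβ (SY ℓ)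
    have h := h1.add h2
    have e : ∑ ℓ, (1 - (SU ℓ).H) + ∑ ℓ, (SY ℓ).H = (m : ℝ) - channelInfo P W := by
      rw [← sum_H_sub_sum_H P W f, Finset.sum_sub_distrib]
      simp only [Finset.sum_const, Finset.card_univ, Fintype.card_fin, nsmul_eq_mul, mul_one]
      ring
    rw [e] at h
    refine h.congr fun n => ?_
    simp only [zU_eq_Z_node, zUY_eq_Z_node]
    rw [Finset.sum_add_distrib, add_div, ← sum_indic_div_eq, ← sum_indic_div_eq]
  have hthr := eventually_threshold_le hβ0 (le_max_left β (1 / 4))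
  have hunion : Tendsto (fun n : ℕ => (∑ a : Fin m × Fin (2 ^ n),
      indic (zU P W f n a.1 a.2 < threshold β n ∨ 1 - threshold β n < zUY P W f n a.1 a.2))
        / (2 : ℝ) ^ n) atTop (𝓝 ((m : ℝ) - channelInfo P W)) := by
    refine tendsto_of_abs_sum_sub_le ?_ hbad hsum
    filter_upwards [hthr] with n hn a
    exact abs_indic_union_sub_le (zUY_le_zU P W f n a.1 a.2) hn.2
  refine ⟨hunion.congr fun n => ?_, ?_⟩
  · rw [card_eq_sum_indic]
    simp only [lowU, highUY, Finset.mem_union, Finset.mem_filter, Finset.mem_univ,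
      true_and, gt_iff_lt]
  · have hcompl : Tendsto (fun n : ℕ => (∑ a : Fin m × Fin (2 ^ n), (1 -
        indic (zU P W f n a.1 a.2 < threshold β n ∨ 1 - threshold β n < zUY P W f n a.1 a.2)))
          / (2 : ℝ) ^ n) atTop (𝓝 (channelInfo P W)) := by
      have h := hunion.const_sub (m : ℝ)
      rw [sub_sub_cancel] at h
      refine h.congr fun n => ?_
      rw [Finset.sum_sub_distrib, sub_div]
      congr 1
      simp
    refine (tendsto_of_abs_sum_sub_le (φ := fun n (a : Fin m × Fin (2 ^ n)) =>
      indic (1 - threshold β n < zU P W f n a.1 a.2 ∧ zUY P W f n a.1 a.2 < threshold β n))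
      ?_ hbad hcompl).congr fun n => ?_
    · filter_upwards [hthr] with n hn a
      exact abs_indic_data_sub_le hn.1 hn.2
    · rw [card_eq_sum_indic]
      simp only [dataSet, highU, lowUY, Finset.mem_inter, Finset.mem_filter, Finset.mem_univ,
        true_and, gt_iff_lt]
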